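/- For positive integers $\ell,m$ let $r(\ell,m)$ be the Ramsey number: the smallest positive integer $n$ such that every red-blue coloring of the edges of the complete graph $K_n$ contains a red clique on $\ell$ vertices or a blue clique on $m$ vertices. Let $C>1$ be a real number. Then there is a unique $p_C\in(0,1/2)$ with $C=\frac{\log p_C}{\log(1-p_C)}$, and there exist $\varepsilon=\varepsilon(C)>0$ and a positive integer $\ell_0=\ell_0(C)$ such that for all integers $\ell\ge\ell_0$ $$r(\ell,\lfloor C\ell\rfloor)\ \ge\ \bigl(p_C^{-1/2}+\varepsilon\bigr)^{\ell}.$$ -/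

import Mathlib

/-- `IsRamsey n ℓ m`: every red-blue colouring of the edges of the complete graph on `n` vertices
contains a red clique on `ℓ` vertices or a blue clique on `m` vertices. A colouring is given by the
graph `G` formed by the red edges; the blue edges are then those of the complement `Gᶜ`. -/
def IsRamsey (n ℓ m : ℕ) : Prop :=
  ∀ G : SimpleGraph (Fin n),
    (∃ s : Finset (Fin n), G.IsNClique ℓ s) ∨ (∃ s : Finset (Fin n), Gᶜ.IsNClique m s)

/-- The Ramsey number `r(ℓ, m)`: the smallest positive integer `n` with `IsRamsey n ℓ m`. -/
noncomputable def ramseyNumber (ℓ m : ℕ) : ℕ :=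
  sInf {n : ℕ | 0 < n ∧ IsRamsey n ℓ m}

/-- Ramsey's theorem for two colours, inside finite sets of vertices of arbitrary graphs. -/
theorem exists_ramsey_bound (ℓ m : ℕ) :
    ∃ n : ℕ, ∀ (V : Type) (G : SimpleGraph V) (S : Finset V), n ≤ S.card →
      (∃ s ⊆ S, G.IsNClique ℓ s) ∨ (∃ s ⊆ S, Gᶜ.IsNClique m s) := by
  classical
  induction ℓ generalizing m with
  | zero =>
    exact ⟨0, fun V G S _ => Or.inl ⟨∅, by simp, by simp [SimpleGraph.isNClique_iff]⟩⟩
  | succ a iha =>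
    induction m with
    | zero =>
      exact ⟨0, fun V G S _ => Or.inr ⟨∅, by simp, by simp [SimpleGraph.isNClique_iff]⟩⟩
    | succ b ihb =>
      obtain ⟨n₁, h₁⟩ := iha (b + 1)
      obtain ⟨n₂, h₂⟩ := ihb
      refine ⟨n₁ + n₂ + 1, fun V G S hS => ?_⟩
      obtain ⟨v, hv⟩ : S.Nonempty := Finset.card_pos.mp (by omega)
      have hA : (S.erase v).filter (G.Adj v) ⊆ S :=
        (Finset.filter_subset _ _).trans (Finset.erase_subset _ _)
      have hB : (S.erase v).filter (fun w => ¬ G.Adj v w) ⊆ S :=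
        (Finset.filter_subset _ _).trans (Finset.erase_subset _ _)
      have hcard := Finset.card_filter_add_card_filter_not (s := S.erase v) (G.Adj v)
      rw [Finset.card_erase_of_mem hv] at hcard
      rcases le_or_gt n₁ ((S.erase v).filter (G.Adj v)).card with h | h
      · rcases h₁ V G _ h with ⟨s, hs, hc⟩ | ⟨s, hs, hc⟩
        · refine Or.inl ⟨insert v s, Finset.insert_subset hv (hs.trans hA), hc.insert ?_⟩
          exact fun w hw => (Finset.mem_filter.mp (hs hw)).2
        · exact Or.inr ⟨s, hs.trans hA, hc⟩
      · rcases h₂ V G ((S.erase v).filter (fun w => ¬ G.Adj v w)) (by omega) with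
          ⟨s, hs, hc⟩ | ⟨s, hs, hc⟩
        · exact Or.inl ⟨s, hs.trans hB, hc⟩
        · refine Or.inr ⟨insert v s, Finset.insert_subset hv (hs.trans hB), hc.insert ?_⟩
          intro w hw
          have hw' := Finset.mem_filter.mp (hs hw)
          rw [SimpleGraph.compl_adj]
          exact ⟨(Finset.ne_of_mem_erase hw'.1).symm, hw'.2⟩

/-- The set whose smallest element is the Ramsey number is non-empty, so that `ramseyNumber`
really is its smallest element. -/
theorem ramseyNumber_spec (ℓ m : ℕ) :
    IsLeast {n : ℕ | 0 < n ∧ IsRamsey n ℓ m} (ramseyNumber ℓ m) := by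
  obtain ⟨n, hn⟩ := exists_ramsey_bound ℓ m
  have hne : {n : ℕ | 0 < n ∧ IsRamsey n ℓ m}.Nonempty := by
    refine ⟨n + 1, Nat.succ_pos n, fun G => ?_⟩
    rcases hn (Fin (n + 1)) G Finset.univ (by simp) with ⟨s, -, hs⟩ | ⟨s, -, hs⟩
    · exact Or.inl ⟨s, hs⟩
    · exact Or.inr ⟨s, hs⟩
  exact ⟨Nat.sInf_mem hne, fun k hk => Nat.sInf_le hk⟩

/-! The colouring is random but steered by Gaussian geometry. Vertices become independent standard
Gaussian vectors in dimension `d`, and given these vectors a pair `u, v` is red, independently of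
the others, with probability `p' - b * sign ⟨u, v⟩`. Relative to an unbiased colouring, the expected
weight of an `m`-clique is at most `exp ((c * μ) ^ 3 * (m choose 3) / √d)` times a small error,
where `μ` is `gaussianAbsMean` and `c` is `-b / p'` for red and `b / (1 - p')` for blue. The cubic
term comes from triangles. It is negative for red, a gain, and positive for blue, a loss.

With `d = D * ℓ ^ 2` this term is of order `ℓ ^ 2 / √D`, comparable to the number of pairs in a
clique. Put `κ = 1 / √D`. At `p' = p_C` and `κ = 0` both first-moment rates vanish for `n = p_C ^
(-ℓ / 2)`. Moving to `p' = p_C + θ * κ` spends the red gain on the blue loss. To first order in `κ`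
a suitable `θ` exists because `C * p ^ 2 < (1 - p) ^ 2`, which is `sq_mul_log_lt`; the error terms
are of order `κ ^ 2`. For small `κ` both rates are negative, leaving room to enlarge `n` by an
exponential factor.

The clique weight is estimated by integrating out one vector at a time (`lintegral_clique_step`,
iterated in `lintegral_clique_almostOrthogonal_le`). While the earlier vectors are almost
orthogonal, their inner products with a fresh vector have a law dominated by a perturbed standard
Gaussian law (`lintegral_inner_stdGaussian_le`). The sign tilts have sub-Gaussian moments
(`integral_tilt_exp_le`), so they can be replaced coordinate by coordinate by shifted Gaussians
(`lintegral_prod_mul_le_of_exp`), and an explicit Gaussian integral remains. Almost orthogonality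
fails with probability small enough to beat the union bound
(`pi_stdGaussian_not_almostOrthogonal_le`). `not_isRamsey_of_gaussian` combines these bounds, and
`exp_le_ramseyNumber_of_rates` passes to asymptotics. -/

section Auxiliary

open MeasureTheory ProbabilityTheory Matrix Finset
open scoped ENNReal

/-! ### Fubini and densities on finite powers of a measure. -/

section PiIntegrals

variable {α : Type*} [MeasurableSpace α]

/-- Fubini for a power of a measure, splitting off the first coordinate. -/
theorem lintegral_pi_cons (ν : Measure α) [SigmaFinite ν] (k : ℕ)
    (F : (Fin (k + 1) → α) → ℝ≥0∞) (hF : Measurable F) :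
    ∫⁻ x, F x ∂(Measure.pi fun _ : Fin (k + 1) => ν) =
      ∫⁻ a, ∫⁻ r, F (Fin.cons a r) ∂(Measure.pi fun _ : Fin k => ν) ∂ν := by
  have h := (measurePreserving_piFinSuccAbove (fun _ : Fin (k + 1) => ν) 0).symm
  rw [← h.lintegral_comp_emb (MeasurableEquiv.measurableEmbedding _),
    lintegral_prod _ (by fun_prop)]
  refine lintegral_congr fun a => lintegral_congr fun r => ?_
  congr 1
  simp [MeasurableEquiv.piFinSuccAbove, Fin.insertNthEquiv, Fin.insertNth_zero']

/-- Fubini for a power of a measure, splitting off the last coordinate. -/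
theorem lintegral_pi_snoc (ν : Measure α) [SigmaFinite ν] (k : ℕ)
    (F : (Fin (k + 1) → α) → ℝ≥0∞) (hF : Measurable F) :
    ∫⁻ x, F x ∂(Measure.pi fun _ : Fin (k + 1) => ν) =
      ∫⁻ r, ∫⁻ a, F (Fin.snoc (α := fun _ => α) r a) ∂ν ∂(Measure.pi fun _ : Fin k => ν) := by
  have h := (measurePreserving_piFinSuccAbove (fun _ : Fin (k + 1) => ν) (Fin.last k)).symm
  rw [← h.lintegral_comp_emb (MeasurableEquiv.measurableEmbedding _),
    lintegral_prod_symm _ (by fun_prop)]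
  refine lintegral_congr fun r => lintegral_congr fun a => ?_
  congr 1
  simp [MeasurableEquiv.piFinSuccAbove, Fin.insertNthEquiv, Fin.insertNth_last']

theorem measurable_fin_cons (k : ℕ) :
    Measurable fun p : α × (Fin k → α) => (Fin.cons p.1 p.2 : Fin (k + 1) → α) := by
  refine measurable_pi_lambda _ fun i => ?_
  refine Fin.cases ?_ (fun j => ?_) i
  · simpa using measurable_fst
  · simpa using by fun_prop

theorem lintegral_pi_prod (ν : Measure α) [SigmaFinite ν] (k : ℕ)
    (f : Fin k → α → ℝ≥0∞) (hf : ∀ i, Measurable (f i)) :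
    ∫⁻ x, ∏ i, f i (x i) ∂(Measure.pi fun _ : Fin k => ν) = ∏ i, ∫⁻ a, f i a ∂ν := by
  induction k with
  | zero => simp
  | succ k ih =>
    rw [lintegral_pi_cons _ _ _ (by fun_prop)]
    simp only [Fin.prod_univ_succ, Fin.cons_zero, Fin.cons_succ]
    simp_rw [lintegral_const_mul _ (show Measurable fun r : Fin k → α =>
      ∏ i : Fin k, f i.succ (r i) by fun_prop)]
    rw [lintegral_mul_const _ (hf 0), ih _ fun i => hf i.succ]

theorem pi_withDensity (ν : Measure α) [SigmaFinite ν] (k : ℕ) (f : α → ℝ≥0∞) (hf : Measurable f)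
    [SigmaFinite (ν.withDensity f)] :
    (Measure.pi fun _ : Fin k => ν.withDensity f) =
      (Measure.pi fun _ : Fin k => ν).withDensity fun x => ∏ i, f (x i) := by
  refine Measure.pi_eq fun s hs => ?_
  have h1 : ∀ x : Fin k → α, (Set.univ.pi s).indicator (fun x => ∏ i, f (x i)) x =
      ∏ i, (s i).indicator f (x i) := by
    intro x
    by_cases hx : x ∈ Set.univ.pi s
    · rw [Set.indicator_of_mem hx]
      exact prod_congr rfl fun i _ => (Set.indicator_of_mem (hx i trivial) f).symm
    · rw [Set.indicator_of_notMem hx]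
      obtain ⟨i, hi⟩ : ∃ i, x i ∉ s i := by simpa using hx
      exact (prod_eq_zero (mem_univ i) (Set.indicator_of_notMem hi f)).symm
  rw [withDensity_apply _ (MeasurableSet.univ_pi hs), ← lintegral_indicator
    (MeasurableSet.univ_pi hs)]
  simp_rw [h1]
  rw [lintegral_pi_prod _ _ _ fun i => hf.indicator (hs i)]
  exact prod_congr rfl fun i _ => by
    rw [lintegral_indicator (hs i), withDensity_apply _ (hs i)]

end PiIntegrals

/-! ### Linear change of variables for Gaussian measures. -/

/-- The standard Gaussian measure on `ℝ ^ k`. -/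
noncomputable abbrev gaussianPi (k : ℕ) : Measure (Fin k → ℝ) :=
  Measure.pi fun _ => gaussianReal 0 1

theorem gaussianPi_eq_withDensity (k : ℕ) :
    gaussianPi k = (volume : Measure (Fin k → ℝ)).withDensity fun u =>
      ENNReal.ofReal ((Real.sqrt (2 * Real.pi))⁻¹ ^ k * Real.exp (-(u ⬝ᵥ u) / 2)) := by
  have h : gaussianReal 0 1 = volume.withDensity (gaussianPDF 0 1) :=
    gaussianReal_of_var_ne_zero 0 one_ne_zero
  have : SigmaFinite ((volume : Measure ℝ).withDensity (gaussianPDF 0 1)) := by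
    rw [← h]; infer_instance
  simp only [gaussianPi]
  rw [h, pi_withDensity _ _ _ (measurable_gaussianPDF 0 1)]
  congr 1
  funext u
  simp only [gaussianPDF, gaussianPDFReal]
  rw [← ENNReal.ofReal_prod_of_nonneg fun i _ => by positivity]
  congr 1
  rw [prod_mul_distrib, prod_const, ← Real.exp_sum, card_univ, Fintype.card_fin]
  simp [dotProduct, sum_div, sum_neg_distrib, sq, neg_div]

/-- Change of variables for the standard Gaussian measure under an invertible matrix. -/
theorem lintegral_gaussianPi_mulVec {k : ℕ} (S A : Matrix (Fin k) (Fin k) ℝ) (hSA : A * S = 1)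
    (F : (Fin k → ℝ) → ℝ≥0∞) (hF : Measurable F) :
    ∫⁻ g, F (A *ᵥ g) ∂gaussianPi k = ENNReal.ofReal |S.det| *
      ∫⁻ u, F u * ENNReal.ofReal (Real.exp ((u ⬝ᵥ u - (S *ᵥ u) ⬝ᵥ (S *ᵥ u)) / 2))
        ∂gaussianPi k := by
  have hdet : A.det * S.det = 1 := by rw [← det_mul, hSA, det_one]
  have hS0 : S.det ≠ 0 := right_ne_zero_of_mul_eq_one hdet
  have hmap := Real.map_matrix_volume_pi_eq_smul_volume_pi hS0
  have hSm : Measurable fun u : Fin k → ℝ => S *ᵥ u :=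
    (LinearMap.continuous_on_pi (toLin' S)).measurable
  have hAm : Measurable fun u : Fin k → ℝ => A *ᵥ u :=
    (LinearMap.continuous_on_pi (toLin' A)).measurable
  have hdot : ∀ B : Matrix (Fin k) (Fin k) ℝ, Measurable fun u : Fin k → ℝ => B *ᵥ u ⬝ᵥ B *ᵥ u := by
    intro B
    have := (LinearMap.continuous_on_pi (toLin' B))
    exact (Continuous.dotProduct this this).measurable
  have hdot1 : Measurable fun u : Fin k → ℝ => u ⬝ᵥ u := by simpa using hdot 1
  have hvol : ∀ H : (Fin k → ℝ) → ℝ≥0∞, Measurable H →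
      ∫⁻ g, H g = ENNReal.ofReal |S.det| * ∫⁻ u, H (S *ᵥ u) := by
    intro H hH
    have h1 : ∫⁻ u, H (S *ᵥ u) = ENNReal.ofReal |S.det⁻¹| * ∫⁻ g, H g := by
      have h2 := congrArg (fun m => ∫⁻ g, H g ∂m) hmap
      simp only [lintegral_smul_measure, smul_eq_mul] at h2
      rw [← h2, lintegral_map hH (show Measurable (toLin' S) from hSm)]
      rfl
    rw [h1, ← mul_assoc, ← ENNReal.ofReal_mul (abs_nonneg _), ← abs_mul, mul_inv_cancel₀ hS0]
    simp
  rw [gaussianPi_eq_withDensity, lintegral_withDensity_eq_lintegral_mul _ (by fun_prop)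
    (show Measurable fun g => F (A *ᵥ g) from hF.comp hAm), lintegral_withDensity_eq_lintegral_mul _ (by fun_prop) (by fun_prop),
    hvol _ (by fun_prop)]
  congr 1
  refine lintegral_congr fun u => ?_
  have : A *ᵥ S *ᵥ u = u := by rw [mulVec_mulVec, hSA, one_mulVec]
  simp only [Pi.mul_apply, this]
  rw [mul_comm (F u), ← mul_assoc, ← ENNReal.ofReal_mul (by positivity), mul_assoc, ← Real.exp_add]
  ring_nf

/-! ### Small trace-zero perturbations of the identity, and Gaussian vectors with such covariance.
-/

section

open scoped MatrixOrder

theorem exp_sub_sq_le_one_add {t : ℝ} (ht : |t| ≤ 1 / 4) : Real.exp (t - t ^ 2) ≤ 1 + t := by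
  obtain ⟨h1, h2⟩ := abs_le.1 ht
  have hpos : 0 < 1 + t := by linarith
  rw [← Real.le_log_iff_exp_le hpos]
  rcases le_or_gt 0 t with ht | ht
  · refine le_trans ?_ (Real.one_sub_inv_le_log_of_pos (x := 1 + t) hpos)
    rw [le_sub_iff_add_le, ← le_sub_iff_add_le', inv_le_comm₀ hpos (by nlinarith),
      inv_le_iff_one_le_mul₀ (by nlinarith)]
    nlinarith [pow_nonneg ht 3]
  -- For negative `t` the bound `1 - 1 / x ≤ log x` at `x = 1 + t` is too weak by a cubic term;
  -- applied at the square root and doubled it loses only `3 t ^ 2 / 4` at second order.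
  · have h5 : Real.log (1 + t) = 2 * Real.log (Real.sqrt (1 + t)) := by
      rw [Real.log_sqrt hpos.le]; ring
    have hsq := Real.sq_sqrt hpos.le
    set r := Real.sqrt (1 + t)
    have hr : 0 < r := Real.sqrt_pos.2 hpos
    have h6 := Real.one_sub_inv_le_log_of_pos (x := r) hr
    rw [h5]
    refine le_trans ?_ (mul_le_mul_of_nonneg_left h6 zero_le_two)
    have ht' : t = r ^ 2 - 1 := by linarith
    have hr1 : r < 1 := by nlinarith
    have hr2 : 3 / 4 ≤ r ^ 2 := by linarith
    have : r * (r ^ 2 - 1 - (r ^ 2 - 1) ^ 2) ≤ 2 * (r - 1) := by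
      have hr3 : 2 / 3 ≤ r := by nlinarith
      have hr4 : 0 ≤ r ^ 3 + 2 * r ^ 2 - 2 := by nlinarith
      nlinarith [mul_nonneg (mul_nonneg (sub_nonneg.2 hr1.le) (sub_nonneg.2 hr1.le)) hr4,
        mul_nonneg (sub_nonneg.2 hr1.le) hr4]
    rw [ht']
    have h7 : 2 * (1 - r⁻¹) = (2 * (r - 1)) / r := by field_simp
    rw [h7, le_div_iff₀ hr]
    linarith

section QuadraticForms

theorem dotProduct_self_nonneg {k : ℕ} (x : Fin k → ℝ) : 0 ≤ x ⬝ᵥ x := by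
  simpa using dotProduct_star_self_nonneg x

variable {k : ℕ} (E : Matrix (Fin k) (Fin k) ℝ)

theorem mulVec_dotProduct_self_le (x : Fin k → ℝ) :
    (E *ᵥ x) ⬝ᵥ (E *ᵥ x) ≤ (∑ i, ∑ j, E i j ^ 2) * (x ⬝ᵥ x) := by
  simp only [dotProduct, mulVec, ← sq]
  rw [sum_mul]
  exact sum_le_sum fun i _ => sum_mul_sq_le_sq_mul_sq _ _ _

theorem abs_dotProduct_mulVec_le {δ : ℝ} (hδ : 0 ≤ δ) (hE : ∑ i, ∑ j, E i j ^ 2 ≤ δ ^ 2)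
    (x : Fin k → ℝ) : |x ⬝ᵥ (E *ᵥ x)| ≤ δ * (x ⬝ᵥ x) := by
  have hx : 0 ≤ x ⬝ᵥ x := dotProduct_self_nonneg x
  refine abs_le_of_sq_le_sq ?_ (by positivity)
  have h1 : (x ⬝ᵥ (E *ᵥ x)) ^ 2 ≤ (x ⬝ᵥ x) * ((E *ᵥ x) ⬝ᵥ (E *ᵥ x)) := by
    simp only [dotProduct, ← sq]
    exact sum_mul_sq_le_sq_mul_sq _ _ _
  have h2 := mulVec_dotProduct_self_le E x
  have h3 := mul_le_mul_of_nonneg_right hE hx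
  nlinarith [mul_le_mul_of_nonneg_left (h2.trans h3) hx]

/-- A lower bound for the determinant of a trace zero perturbation of the identity. -/
theorem exp_neg_le_det_one_add (hE : E.IsHermitian) (htr : E.trace = 0)
    (hF : ∑ i, ∑ j, E i j ^ 2 ≤ 1 / 16) :
    Real.exp (-∑ i, ∑ j, E i j ^ 2) ≤ (1 + E).det := by
  set U : Matrix (Fin k) (Fin k) ℝ := (hE.eigenvectorUnitary : Matrix (Fin k) (Fin k) ℝ) with hU
  set D : Matrix (Fin k) (Fin k) ℝ := diagonal hE.eigenvalues with hD
  have hUU : U * star U = 1 := Unitary.coe_mul_star_self _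
  have hUU' : star U * U = 1 := Unitary.coe_star_mul_self _
  have hspec : E = U * D * star U := by
    have := hE.spectral_theorem
    rw [Unitary.conjStarAlgAut_apply] at this
    simpa [hD, hU, Function.comp_def] using this
  have hdet : (1 + E).det = ∏ i, (1 + hE.eigenvalues i) := by
    have h1 : 1 + E = U * (1 + D) * star U := by
      rw [Matrix.mul_add, Matrix.add_mul, mul_one, hUU, ← hspec]
    have h2 : U.det * (star U).det = 1 := by rw [← det_mul, hUU, det_one]
    have h3 : (1 + D) = diagonal (fun i => 1 + hE.eigenvalues i) := by
      rw [hD, ← diagonal_one, diagonal_add]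
    rw [h1, det_mul, det_mul, mul_right_comm, h2, one_mul, h3, det_diagonal]
  -- Trace zero removes the first-order term, so the determinant differs from 1 only by the squared
  -- Frobenius norm in the exponent.
  have hsum : ∑ i, hE.eigenvalues i = 0 := by
    have := hE.trace_eq_sum_eigenvalues
    rw [htr] at this
    simpa using this.symm
  have hsq : ∑ i, hE.eigenvalues i ^ 2 = ∑ i, ∑ j, E i j ^ 2 := by
    have h1 : (E * E).trace = ∑ i, hE.eigenvalues i ^ 2 := by
      have : E * E = U * (D * D) * star U := by
        conv_lhs => rw [hspec]
        calc U * D * star U * (U * D * star U) = U * D * (star U * U) * D * star U := by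
              simp only [Matrix.mul_assoc]
          _ = _ := by rw [hUU', mul_one]; simp only [Matrix.mul_assoc]
      rw [this, trace_mul_comm, ← Matrix.mul_assoc, hUU', one_mul, hD, diagonal_mul_diagonal,
        trace_diagonal]
      simp [sq]
    rw [← h1, trace]
    refine sum_congr rfl fun i _ => ?_
    rw [diag_apply, mul_apply]
    refine sum_congr rfl fun j _ => ?_
    have : E j i = E i j := by simpa using hE.apply i j
    rw [this, sq]
  have hle : ∀ i, Real.exp (hE.eigenvalues i - hE.eigenvalues i ^ 2) ≤ 1 + hE.eigenvalues i := by
    intro i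
    have h1 : hE.eigenvalues i ^ 2 ≤ (1 / 4) ^ 2 := by
      refine (single_le_sum (f := fun i => hE.eigenvalues i ^ 2) (fun j _ => sq_nonneg _)
        (mem_univ i)).trans ?_
      rw [hsq]; linarith
    exact exp_sub_sq_le_one_add (abs_le_of_sq_le_sq h1 (by norm_num))
  rw [hdet]
  calc Real.exp (-∑ i, ∑ j, E i j ^ 2)
      = ∏ i, Real.exp (hE.eigenvalues i - hE.eigenvalues i ^ 2) := by
        rw [← Real.exp_sum, sum_sub_distrib, hsum, hsq, zero_sub]
    _ ≤ _ := prod_le_prod (fun i _ => (Real.exp_pos _).le) fun i _ => hle i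

/-- The Frobenius bound controls the quadratic form, so `1 + E` is positive and has a square root;
`|B⁻¹.det|` is the Gaussian normalising constant `det (1 + E) ^ (-1/2)`. This serves both for a
covariance `1 + E` and, with `-M`, for integrating `exp` of a quadratic form. -/
theorem exists_transpose_mul_self_eq_one_add (hE : E.IsHermitian) (htr : E.trace = 0) {δ : ℝ}
    (hδ0 : 0 ≤ δ) (hδ : δ ≤ 1 / 4) (hF : ∑ i, ∑ j, E i j ^ 2 ≤ δ ^ 2) :
    ∃ B : Matrix (Fin k) (Fin k) ℝ, 1 + E = Bᵀ * B ∧ B * B⁻¹ = 1 ∧ B⁻¹ * B = 1 ∧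
      |B⁻¹.det| ≤ Real.exp (δ ^ 2 / 2) := by
  have hdet' : Real.exp (-δ ^ 2) ≤ (1 + E).det :=
    (Real.exp_le_exp.2 (by linarith)).trans
      (exp_neg_le_det_one_add E hE htr (hF.trans (by nlinarith)))
  have hpsd : (1 + E).PosSemidef := by
    refine PosSemidef.of_dotProduct_mulVec_nonneg (isHermitian_one.add hE) fun x => ?_
    have h1 := (abs_le.1 (abs_dotProduct_mulVec_le E hδ0 hF x)).1
    have hx : 0 ≤ x ⬝ᵥ x := dotProduct_self_nonneg x
    simp only [star_trivial, add_mulVec, one_mulVec, dotProduct_add]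
    nlinarith
  obtain ⟨B, hB⟩ : ∃ B : Matrix (Fin k) (Fin k) ℝ, 1 + E = Bᵀ * B := by
    obtain ⟨X, hX, -, hXX⟩ := CFC.exists_sqrt_of_isSelfAdjoint_of_quasispectrumRestricts
      hpsd.isHermitian (QuasispectrumRestricts.nnreal_of_nonneg hpsd.nonneg)
    refine ⟨X, ?_⟩
    have : Xᵀ = X := by
      rw [← conjTranspose_eq_transpose_of_trivial]; exact hX.star_eq
    rw [this]; exact hXX.symm
  have hdA : B.det ^ 2 = (1 + E).det := by rw [hB, det_mul, det_transpose B, sq]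
  have hpos : 0 < (1 + E).det := lt_of_lt_of_le (Real.exp_pos _) hdet'
  have hB0 : B.det ≠ 0 := fun h => by rw [h] at hdA; norm_num at hdA; linarith
  refine ⟨B, hB, mul_nonsing_inv _ (isUnit_iff_ne_zero.2 hB0),
    nonsing_inv_mul _ (isUnit_iff_ne_zero.2 hB0), ?_⟩
  refine abs_le_of_sq_le_sq ?_ (Real.exp_pos _).le
  have h1 : B⁻¹.det ^ 2 = ((1 + E).det)⁻¹ := by
    rw [← hdA, det_nonsing_inv, Ring.inverse_eq_inv', inv_pow]
  rw [h1, ← Real.exp_nat_mul, inv_le_comm₀ hpos (Real.exp_pos _), ← Real.exp_neg]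
  refine le_trans (le_of_eq ?_) hdet'
  congr 1; push_cast; ring

end QuadraticForms

section GaussianVectors

variable {V W H : Type*} [NormedAddCommGroup V] [InnerProductSpace ℝ V] [FiniteDimensional ℝ V]
  [MeasurableSpace V] [BorelSpace V] [NormedAddCommGroup W] [InnerProductSpace ℝ W]
  [FiniteDimensional ℝ W] [MeasurableSpace W] [BorelSpace W] [NormedAddCommGroup H]
  [InnerProductSpace ℝ H] [FiniteDimensional ℝ H] [MeasurableSpace H] [BorelSpace H]

/-- The characteristic function of a linear image of a standard Gaussian at `t` depends only on the
norm of the adjoint at `t`. -/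
theorem map_stdGaussian_eq_of_norm_eq (f : V → H) (hf : Measurable f) (f' : H → V)
    (hff : ∀ x t, inner ℝ (f x) t = inner ℝ x (f' t)) (g : W → H) (hg : Measurable g) (g' : H → W)
    (hgg : ∀ x t, inner ℝ (g x) t = inner ℝ x (g' t)) (h : ∀ t, ‖f' t‖ = ‖g' t‖) :
    (stdGaussian V).map f = (stdGaussian W).map g := by
  have key : ∀ {X : Type _} [NormedAddCommGroup X] [InnerProductSpace ℝ X]
      [FiniteDimensional ℝ X] [MeasurableSpace X] [BorelSpace X] (f : X → H) (_ : Measurable f)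
      (f' : H → X) (_ : ∀ x t, inner ℝ (f x) t = inner ℝ x (f' t)) (t : H),
      charFun ((stdGaussian X).map f) t = Complex.exp (-‖f' t‖ ^ 2 / 2) := by
    intro X _ _ _ _ _ f hf f' hff t
    rw [charFun_apply, integral_map hf.aemeasurable (by fun_prop)]
    simp_rw [hff]
    rw [← charFun_apply, charFun_stdGaussian]
  have := isProbabilityMeasure_stdGaussian (E := V)
  have := isProbabilityMeasure_stdGaussian (E := W)
  have := Measure.isProbabilityMeasure_map (μ := stdGaussian V) hf.aemeasurable
  have := Measure.isProbabilityMeasure_map (μ := stdGaussian W) hg.aemeasurable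
  refine Measure.ext_of_charFun ?_
  ext t
  have a1 := key f hf f' hff t
  rw [a1, charFun_apply, integral_map hg.aemeasurable (by fun_prop)]
  simp_rw [hgg]
  rw [← charFun_apply, charFun_stdGaussian, h]

theorem lintegral_inner_stdGaussian {k : ℕ} (v : Fin k → V) (A : Matrix (Fin k) (Fin k) ℝ)
    (hA : ∀ i j, (A * Aᵀ) i j = inner ℝ (v i) (v j)) (F : (Fin k → ℝ) → ℝ≥0∞) (hF : Measurable F) :
    ∫⁻ x, F (fun i => inner ℝ (v i) x) ∂stdGaussian V = ∫⁻ g, F (A *ᵥ g) ∂gaussianPi k := by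
  have hAm : ∀ B : Matrix (Fin k) (Fin k) ℝ, Measurable fun u : Fin k → ℝ => B *ᵥ u :=
    fun B => (LinearMap.continuous_on_pi (toLin' B)).measurable
  have hmap := map_stdGaussian_eq_of_norm_eq (V := V) (W := EuclideanSpace ℝ (Fin k))
    (H := EuclideanSpace ℝ (Fin k)) (fun x => WithLp.toLp 2 fun i => inner ℝ (v i) x)
    (by fun_prop) (fun t => ∑ i, t i • v i) ?_
    (fun x => WithLp.toLp 2 (A *ᵥ x.ofLp)) ?_ (fun t => WithLp.toLp 2 (Aᵀ *ᵥ t.ofLp)) ?_ ?_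
  · have h1 : ∫⁻ x, F (fun i => inner ℝ (v i) x) ∂stdGaussian V =
        ∫⁻ z, F z.ofLp ∂((stdGaussian V).map
          fun x => (WithLp.toLp 2 fun i => inner ℝ (v i) x : EuclideanSpace ℝ (Fin k))) := by
      rw [lintegral_map (by fun_prop) (by fun_prop)]
    have hAm' := hAm A
    rw [h1, hmap, lintegral_map (by fun_prop) (by fun_prop), ← map_pi_eq_stdGaussian,
      lintegral_map (by fun_prop) (by fun_prop)]
  · intro x t
    rw [inner_sum, PiLp.inner_apply]
    refine sum_congr rfl fun i _ => ?_
    simp [real_inner_smul_right, real_inner_comm]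
  · have hAm' := hAm A
    fun_prop
  · intro x t
    simp only [EuclideanSpace.inner_eq_star_dotProduct]
    simp [dotProduct_mulVec, vecMul_transpose, dotProduct_comm]
  · intro t
    rw [← sq_eq_sq₀ (norm_nonneg _) (norm_nonneg _), ← real_inner_self_eq_norm_sq,
      ← real_inner_self_eq_norm_sq]
    have h2 : inner ℝ (∑ i, t i • v i) (∑ i, t i • v i) = t.ofLp ⬝ᵥ ((A * Aᵀ) *ᵥ t.ofLp) := by
      simp only [sum_inner, inner_sum, dotProduct, mulVec, hA, mul_sum]
      refine sum_congr rfl fun i _ => sum_congr rfl fun j _ => ?_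
      simp only [real_inner_smul_left, real_inner_smul_right]
      rw [real_inner_comm]; ring
    rw [h2, EuclideanSpace.inner_eq_star_dotProduct, ← mulVec_mulVec, dotProduct_mulVec,
      ← mulVec_transpose]
    simp

/-- The joint law of the inner products of a Gaussian vector with almost orthonormal vectors is
dominated by an explicit perturbation of the standard Gaussian law. -/
theorem lintegral_inner_stdGaussian_le {k : ℕ} (v : Fin k → V) (E : Matrix (Fin k) (Fin k) ℝ)
    (hv : ∀ i j, (1 + E) i j = inner ℝ (v i) (v j)) (htr : E.trace = 0) {δ : ℝ} (hδ0 : 0 ≤ δ)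
    (hδ : δ ≤ 1 / 4) (hE : ∑ i, ∑ j, E i j ^ 2 ≤ δ ^ 2)
    (F : (Fin k → ℝ) → ℝ≥0∞) (hF : Measurable F) :
    ∫⁻ x, F (fun i => inner ℝ (v i) x) ∂stdGaussian V ≤ ENNReal.ofReal (Real.exp (δ ^ 2 / 2)) *
      ∫⁻ u, F u * ENNReal.ofReal (Real.exp (u ⬝ᵥ (E *ᵥ u) / 2)) ∂gaussianPi k := by
  have hEs : E.IsHermitian := by
    refine IsHermitian.ext fun i j => ?_
    have h1 := hv i j
    have h2 := hv j i
    rw [real_inner_comm] at h2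
    simp only [Matrix.add_apply, one_apply] at h1 h2
    rw [star_trivial]
    by_cases hij : i = j
    · subst hij; rfl
    · rw [if_neg hij] at h1; rw [if_neg (Ne.symm hij)] at h2; linarith
  obtain ⟨B, hB, hBB, -, hBdet⟩ := exists_transpose_mul_self_eq_one_add E hEs htr hδ0 hδ hE
  set A := Bᵀ with hA
  set S := (B⁻¹)ᵀ with hS
  have hAA : A * Aᵀ = 1 + E := by rw [hB, hA, transpose_transpose]
  have hAS' : B⁻¹ * B = 1 := mul_eq_one_comm.1 hBB
  have hAS : A * S = 1 := by rw [hA, hS, ← transpose_mul, hAS', transpose_one]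
  rw [lintegral_inner_stdGaussian v A (fun i j => by rw [hAA, hv]) F hF,
    lintegral_gaussianPi_mulVec S A hAS F hF]
  refine mul_le_mul' (ENNReal.ofReal_le_ofReal ?_) (lintegral_mono fun u =>
    mul_le_mul_right (ENNReal.ofReal_le_ofReal (Real.exp_le_exp.2 ?_)) _)
  · rwa [hS, det_transpose]
  -- Expanding this square gives the form inequality `(1 + E)⁻¹ ≥ 1 - E`, which bounds the exponent
  -- of the density by one linear in `E`.
  · have h1 : 0 ≤ (S *ᵥ u - Aᵀ *ᵥ u) ⬝ᵥ (S *ᵥ u - Aᵀ *ᵥ u) := dotProduct_self_nonneg _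
    have h2 : (S *ᵥ u) ⬝ᵥ (Aᵀ *ᵥ u) = u ⬝ᵥ u := by
      rw [dotProduct_mulVec, vecMul_transpose, mulVec_mulVec, hAS, one_mulVec]
    have h3 : (Aᵀ *ᵥ u) ⬝ᵥ (Aᵀ *ᵥ u) = u ⬝ᵥ u + u ⬝ᵥ (E *ᵥ u) := by
      rw [dotProduct_mulVec, vecMul_transpose, mulVec_mulVec, hAA, add_mulVec, one_mulVec,
        add_dotProduct, dotProduct_comm (E *ᵥ u)]
    rw [sub_dotProduct, dotProduct_sub, dotProduct_sub, h2, h3, dotProduct_comm (Aᵀ *ᵥ u), h2] at h1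
    linarith

end GaussianVectors

end

/-! ### Coordinatewise replacement and exponentials of quadratic forms. -/

/-- One can replace independent variables by Gaussian variables with larger exponential moments in
the expectation of a function that depends exponentially on each variable separately. -/
theorem lintegral_prod_mul_le_of_exp {k : ℕ} (f : ℝ → ℝ≥0∞) (hf : Measurable f) (P : ℝ≥0∞)
    (a b : ℝ)
    (h : ∀ y : ℝ, ∫⁻ u, f u * ENNReal.ofReal (Real.exp (y * u)) ∂gaussianReal 0 1 ≤
      P * ∫⁻ g, ENNReal.ofReal (Real.exp (y * (a + b * g))) ∂gaussianReal 0 1)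
    (F : (Fin k → ℝ) → ℝ≥0∞) (hF : Measurable F)
    (hexp : ∀ i x, ∃ (c : ℝ≥0∞) (y : ℝ), ∀ t, F (Function.update x i t) =
      c * ENNReal.ofReal (Real.exp (y * t))) :
    ∫⁻ u, (∏ i, f (u i)) * F u ∂gaussianPi k ≤
      P ^ k * ∫⁻ g, F (fun i => a + b * g i) ∂gaussianPi k := by
  induction k with
  | zero =>
    refine le_of_eq ?_
    simp only [univ_eq_empty, prod_empty, one_mul, pow_zero]
    exact lintegral_congr fun x => congrArg F (Subsingleton.elim _ _)
  | succ k ih =>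
    have hcons := measurable_fin_cons (α := ℝ) k
    have hm : Measurable fun p : ℝ × (Fin k → ℝ) => F (Fin.cons p.1 p.2) := hF.comp hcons
    have hm' : Measurable fun p : ℝ × (Fin k → ℝ) =>
        F (Fin.cons p.1 fun i => a + b * p.2 i) :=
      hm.comp (by fun_prop : Measurable fun p : ℝ × (Fin k → ℝ) => (p.1, fun i => a + b * p.2 i))
    have hm'' : Measurable fun p : ℝ × (Fin k → ℝ) =>
        F (Fin.cons (a + b * p.1) fun i => a + b * p.2 i) :=
      hm'.comp (by fun_prop : Measurable fun p : ℝ × (Fin k → ℝ) => (a + b * p.1, p.2))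
    have hrhs : ∫⁻ g, F (fun i => a + b * g i) ∂gaussianPi (k + 1) =
        ∫⁻ r, ∫⁻ t, F (Fin.cons (a + b * t) fun i => a + b * r i) ∂gaussianReal 0 1
          ∂gaussianPi k := by
      rw [lintegral_lintegral_swap (f := fun (r : Fin k → ℝ) t =>
          F (Fin.cons (a + b * t) fun i => a + b * r i)) (hm''.comp measurable_swap).aemeasurable,
        lintegral_pi_cons _ _ _ (by fun_prop)]
      refine lintegral_congr fun t => lintegral_congr fun r => congrArg F ?_
      funext i
      refine Fin.cases ?_ (fun j => ?_) i <;> simp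
    rw [hrhs, lintegral_pi_cons _ _ _ (by fun_prop)]
    calc ∫⁻ t, ∫⁻ r, (∏ i, f ((Fin.cons t r : Fin (k + 1) → ℝ) i)) * F (Fin.cons t r)
          ∂gaussianPi k ∂gaussianReal 0 1
        ≤ ∫⁻ t, f t * (P ^ k * ∫⁻ r, F (Fin.cons t fun i => a + b * r i) ∂gaussianPi k)
            ∂gaussianReal 0 1 := by
          refine lintegral_mono fun t => ?_
          simp only [Fin.prod_univ_succ, Fin.cons_zero, Fin.cons_succ, mul_assoc]
          rw [lintegral_const_mul _ (by fun_prop)]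
          refine mul_le_mul_right (ih _ (by fun_prop) fun i x => ?_) _
          obtain ⟨c, y, hy⟩ := hexp i.succ (Fin.cons t x)
          exact ⟨c, y, fun s => by rw [Fin.cons_update, hy]⟩
      _ = P ^ k * ∫⁻ r, ∫⁻ t, f t * F (Fin.cons t fun i => a + b * r i) ∂gaussianReal 0 1
            ∂gaussianPi k := by
          rw [lintegral_lintegral_swap ((hf.comp measurable_snd).mul
            (hm'.comp measurable_swap)).aemeasurable, ← lintegral_const_mul _
            (Measurable.lintegral_prod_right' (f := fun p : ℝ × (Fin k → ℝ) =>
              f p.1 * F (Fin.cons p.1 fun i => a + b * p.2 i)) (by fun_prop))]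
          refine lintegral_congr fun t => ?_
          simp only
          rw [lintegral_const_mul _ (by fun_prop)]
          ring
      _ ≤ P ^ k * ∫⁻ r, P * ∫⁻ t, F (Fin.cons (a + b * t) fun i => a + b * r i)
            ∂gaussianReal 0 1 ∂gaussianPi k := by
          refine mul_le_mul_right (lintegral_mono fun r => ?_) _
          obtain ⟨c, y, hy⟩ := hexp 0 (Fin.cons 0 fun i => a + b * r i)
          simp only [Fin.update_cons_zero] at hy
          simp only [hy]
          rw [lintegral_const_mul _ (by fun_prop)]
          simp_rw [mul_left_comm (f _) c]
          rw [lintegral_const_mul _ (by fun_prop), mul_left_comm]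
          exact mul_le_mul_right (h y) _
      _ = _ := by
          rw [lintegral_const_mul _ (Measurable.lintegral_prod_right'
            (f := fun p : (Fin k → ℝ) × ℝ => F (Fin.cons (a + b * p.2) fun i => a + b * p.1 i))
            (hm''.comp measurable_swap)), pow_succ, mul_assoc]

theorem lintegral_exp_mul_gaussianReal (y : ℝ) :
    ∫⁻ g, ENNReal.ofReal (Real.exp (y * g)) ∂gaussianReal 0 1 =
      ENNReal.ofReal (Real.exp (y ^ 2 / 2)) := by
  rw [← ofReal_integral_eq_lintegral_ofReal (integrable_exp_mul_gaussianReal y)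
    (Filter.Eventually.of_forall fun x => (Real.exp_pos _).le)]
  have := congrFun (mgf_id_gaussianReal (μ := 0) (v := 1)) y
  simp only [mgf, id_eq] at this
  rw [this]; congr 2; simp

theorem lintegral_exp_dotProduct_gaussianPi {k : ℕ} (b : Fin k → ℝ) :
    ∫⁻ g, ENNReal.ofReal (Real.exp (b ⬝ᵥ g)) ∂gaussianPi k =
      ENNReal.ofReal (Real.exp (b ⬝ᵥ b / 2)) := by
  have : ∀ g : Fin k → ℝ, ENNReal.ofReal (Real.exp (b ⬝ᵥ g)) =
      ∏ i, ENNReal.ofReal (Real.exp (b i * g i)) := by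
    intro g
    rw [← ENNReal.ofReal_prod_of_nonneg fun i _ => (Real.exp_pos _).le, ← Real.exp_sum, dotProduct]
  simp_rw [this]
  rw [lintegral_pi_prod _ _ (fun i t => ENNReal.ofReal (Real.exp (b i * t))) (by fun_prop)]
  simp_rw [lintegral_exp_mul_gaussianReal]
  rw [← ENNReal.ofReal_prod_of_nonneg fun i _ => (Real.exp_pos _).le, ← Real.exp_sum, dotProduct,
    sum_div]
  simp_rw [sq]

theorem measurable_dotProduct_mulVec {k : ℕ} (M : Matrix (Fin k) (Fin k) ℝ) :
    Measurable fun u : Fin k → ℝ => u ⬝ᵥ (M *ᵥ u) := by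
  have := (LinearMap.continuous_on_pi (toLin' M))
  exact (Continuous.dotProduct continuous_id this).measurable

theorem lintegral_exp_quadratic_gaussianPi_le {k : ℕ} (M : Matrix (Fin k) (Fin k) ℝ)
    (hM : M.IsHermitian) (htr : M.trace = 0) {η : ℝ} (hη0 : 0 ≤ η) (hη : η ≤ 1 / 4)
    (hF : ∑ i, ∑ j, M i j ^ 2 ≤ η ^ 2) :
    ∫⁻ u, ENNReal.ofReal (Real.exp (u ⬝ᵥ (M *ᵥ u) / 2)) ∂gaussianPi k ≤
      ENNReal.ofReal (Real.exp (η ^ 2 / 2)) := by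
  obtain ⟨B, hB, hBB, hBB', hdet⟩ := exists_transpose_mul_self_eq_one_add (-M) hM.neg
    (by simp [htr]) hη0 hη (by simpa using hF)
  -- With the constant function 1 the change of variables evaluates the integral exactly, as an
  -- inverse determinant.
  have h := lintegral_gaussianPi_mulVec B B⁻¹ hBB' (fun _ => 1) measurable_const
  simp only [lintegral_const, measure_univ, mul_one, one_mul] at h
  have h2 : ∀ u : Fin k → ℝ, u ⬝ᵥ u - (B *ᵥ u) ⬝ᵥ (B *ᵥ u) = u ⬝ᵥ (M *ᵥ u) := by
    intro u
    have : (B *ᵥ u) ⬝ᵥ (B *ᵥ u) = u ⬝ᵥ u - u ⬝ᵥ (M *ᵥ u) := by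
      rw [dotProduct_mulVec, ← mulVec_transpose, mulVec_mulVec, ← hB, add_mulVec, one_mulVec,
        neg_mulVec, add_dotProduct, neg_dotProduct, dotProduct_comm (M *ᵥ u)]
      ring
    rw [this]; ring
  simp_rw [h2] at h
  have hd : ENNReal.ofReal |B⁻¹.det| * ENNReal.ofReal |B.det| = 1 := by
    rw [← ENNReal.ofReal_mul (abs_nonneg _), ← abs_mul, ← det_mul, hBB']
    simp
  calc _ = ENNReal.ofReal |B⁻¹.det| := by
        rw [← mul_one (ENNReal.ofReal |B⁻¹.det|), h, ← mul_assoc, hd, one_mul]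
    _ ≤ _ := ENNReal.ofReal_le_ofReal hdet

/-- With zero diagonal the quadratic form is affine in each coordinate separately, which is the
shape that coordinatewise replacement requires. -/
theorem exp_quadratic_update {k : ℕ} (E : Matrix (Fin k) (Fin k) ℝ) (hE : E.IsHermitian)
    (hdiag : ∀ i, E i i = 0) (i : Fin k) (x : Fin k → ℝ) :
    ∃ (c : ℝ≥0∞) (y : ℝ), ∀ t,
      ENNReal.ofReal (Real.exp (Function.update x i t ⬝ᵥ (E *ᵥ Function.update x i t) / 2)) =
        c * ENNReal.ofReal (Real.exp (y * t)) := by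
  set x₀ := Function.update x i 0
  refine ⟨ENNReal.ofReal (Real.exp (x₀ ⬝ᵥ (E *ᵥ x₀) / 2)), (E *ᵥ x₀) i, fun t => ?_⟩
  have hx : Function.update x i t = x₀ + t • Pi.single i 1 := by
    funext j
    by_cases hj : j = i
    · subst hj; simp [x₀]
    · simp [x₀, hj]
  have hsym : x₀ ⬝ᵥ (E *ᵥ Pi.single i 1) = (E *ᵥ x₀) i := by
    have : Eᵀ = E := by rw [← conjTranspose_eq_transpose_of_trivial]; exact hE
    rw [dotProduct_mulVec, ← mulVec_transpose, this]; simp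
  rw [← ENNReal.ofReal_mul (Real.exp_pos _).le, ← Real.exp_add, hx]
  congr 2
  rw [mulVec_add, mulVec_smul, dotProduct_add, add_dotProduct, add_dotProduct, dotProduct_smul,
    dotProduct_smul, smul_dotProduct, smul_dotProduct, hsym]
  simp [hdiag]
  ring

/-- The expectation of a product of functions of the inner products of a Gaussian vector with
almost orthonormal vectors. -/
theorem lintegral_prod_inner_le {V : Type*} [NormedAddCommGroup V] [InnerProductSpace ℝ V]
    [FiniteDimensional ℝ V] [MeasurableSpace V] [BorelSpace V] {k : ℕ} (v : Fin k → V)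
    (E : Matrix (Fin k) (Fin k) ℝ) (hE : E.IsHermitian) (hdiag : ∀ i, E i i = 0)
    (hv : ∀ i j, (1 + E) i j = inner ℝ (v i) (v j)) {δ : ℝ} (hδ0 : 0 ≤ δ) (hδ : δ ≤ 1 / 128)
    (hF : ∑ i, ∑ j, E i j ^ 2 ≤ δ ^ 2) (f : ℝ → ℝ≥0∞) (hf : Measurable f) (P : ℝ≥0∞) {μ : ℝ}
    (hμ : |μ| ≤ 1)
    (h : ∀ y : ℝ, ∫⁻ u, f u * ENNReal.ofReal (Real.exp (y * u)) ∂gaussianReal 0 1 ≤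
      P * ENNReal.ofReal (Real.exp (μ * y + 8 * y ^ 2))) :
    ∫⁻ x, ∏ i, f (inner ℝ (v i) x) ∂stdGaussian V ≤
      P ^ k * ENNReal.ofReal (Real.exp (μ ^ 2 * (∑ i, ∑ j, E i j) / 2 +
        δ ^ 2 * (32 * k + 513))) := by
  have htr : E.trace = 0 := by simp [trace, hdiag]
  have hET : Eᵀ = E := by rw [← conjTranspose_eq_transpose_of_trivial]; exact hE
  have hmE := measurable_dotProduct_mulVec E
  have hμ2 : μ ^ 2 ≤ 1 := by rw [← sq_abs]; nlinarith [abs_nonneg μ]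
  have h1 := lintegral_inner_stdGaussian_le v E hv htr hδ0 (by linarith) hF
    (fun u => ∏ i, f (u i)) (by fun_prop)
  -- The substitute variable is `μ + 4 g`, whose moment generating function is exactly `exp (μ y + 8
  -- y ^ 2)`.
  have h2 := lintegral_prod_mul_le_of_exp (k := k) f hf P μ 4 (fun y => by
    refine (h y).trans (mul_le_mul_right (le_of_eq ?_) _)
    have : ∀ g : ℝ, ENNReal.ofReal (Real.exp (y * (μ + 4 * g))) =
        ENNReal.ofReal (Real.exp (y * μ)) * ENNReal.ofReal (Real.exp ((4 * y) * g)) := by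
      intro g
      rw [← ENNReal.ofReal_mul (Real.exp_pos _).le, ← Real.exp_add]; congr 2; ring
    simp_rw [this]
    rw [lintegral_const_mul _ (by fun_prop), lintegral_exp_mul_gaussianReal,
      ← ENNReal.ofReal_mul (Real.exp_pos _).le, ← Real.exp_add]
    congr 2; ring) (fun u => ENNReal.ofReal (Real.exp (u ⬝ᵥ (E *ᵥ u) / 2))) (by fun_prop)
    (exp_quadratic_update E hE hdiag)
  set w : Fin k → ℝ := E *ᵥ (fun _ => 1) with hw
  have hww : w ⬝ᵥ w ≤ δ ^ 2 * k := by
    refine (mulVec_dotProduct_self_le E _).trans ?_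
    have : ((fun _ => 1 : Fin k → ℝ) ⬝ᵥ fun _ => 1) = k := by simp [dotProduct]
    rw [this]
    exact mul_le_mul_of_nonneg_right hF (Nat.cast_nonneg _)
  have hSum : (fun _ => 1 : Fin k → ℝ) ⬝ᵥ w = ∑ i, ∑ j, E i j := by
    simp [hw, dotProduct, mulVec]
  have hquad : ∀ g : Fin k → ℝ, (fun i => μ + 4 * g i) ⬝ᵥ (E *ᵥ fun i => μ + 4 * g i) / 2 =
      μ ^ 2 * (∑ i, ∑ j, E i j) / 2 + ((4 * μ) • w) ⬝ᵥ g + 8 * (g ⬝ᵥ (E *ᵥ g)) := by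
    intro g
    have hg : (fun i => μ + 4 * g i) = μ • (fun _ => 1 : Fin k → ℝ) + (4 : ℝ) • g := by
      funext i; simp
    have hs : (fun _ => 1 : Fin k → ℝ) ⬝ᵥ (E *ᵥ g) = w ⬝ᵥ g := by
      rw [dotProduct_mulVec, ← mulVec_transpose, hET]
    rw [hg, mulVec_add, mulVec_smul, mulVec_smul, dotProduct_add, add_dotProduct, add_dotProduct]
    simp only [dotProduct_smul, smul_dotProduct, smul_eq_mul, ← hw, hs, hSum]
    rw [dotProduct_comm g w]
    ring
  have hlin := lintegral_exp_dotProduct_gaussianPi ((8 * μ) • w)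
  -- The quadratic part `8 g·Eg` is doubled by the splitting in `hexp` and written as half of a form
  -- with matrix `32 E`; `δ ≤ 1/128` makes `32 δ ≤ 1/4`.
  have hq := lintegral_exp_quadratic_gaussianPi_le ((32 : ℝ) • E)
    (by
      refine IsHermitian.ext fun i j => ?_
      have := hE.apply i j
      simp only [star_trivial] at this
      simp [this])
    (by simp [htr]) (η := 32 * δ) (by positivity) (by linarith) (by
      simp only [Matrix.smul_apply, smul_eq_mul, mul_pow, ← mul_sum]
      nlinarith)
  -- The inequality `2 exp (A + B) ≤ exp (2 A) + exp (2 B)` separates the linear part from the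
  -- quadratic part.
  have hexp : ∀ g : Fin k → ℝ,
      ENNReal.ofReal (Real.exp ((fun i => μ + 4 * g i) ⬝ᵥ (E *ᵥ fun i => μ + 4 * g i) / 2)) ≤
      ENNReal.ofReal (Real.exp (μ ^ 2 * (∑ i, ∑ j, E i j) / 2) / 2) *
        (ENNReal.ofReal (Real.exp (((8 * μ) • w) ⬝ᵥ g)) +
          ENNReal.ofReal (Real.exp (g ⬝ᵥ (((32 : ℝ) • E) *ᵥ g) / 2))) := by
    intro g
    rw [← ENNReal.ofReal_add (Real.exp_pos _).le (Real.exp_pos _).le,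
      ← ENNReal.ofReal_mul (by positivity)]
    refine ENNReal.ofReal_le_ofReal ?_
    rw [hquad]
    have e1 : ((8 * μ) • w) ⬝ᵥ g = 2 * (((4 * μ) • w) ⬝ᵥ g) := by
      simp only [smul_dotProduct, smul_eq_mul]; ring
    have e2 : g ⬝ᵥ (((32 : ℝ) • E) *ᵥ g) / 2 = 2 * (8 * (g ⬝ᵥ (E *ᵥ g))) := by
      rw [smul_mulVec, dotProduct_smul, smul_eq_mul]; ring
    rw [e1, e2, add_assoc, Real.exp_add, Real.exp_add]
    set A := ((4 * μ) • w) ⬝ᵥ g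
    set B := 8 * (g ⬝ᵥ (E *ᵥ g))
    have := Real.exp_pos (μ ^ 2 * (∑ i, ∑ j, E i j) / 2)
    have e3 : Real.exp (2 * A) = Real.exp A ^ 2 := by rw [← Real.exp_nat_mul]; norm_num
    have e4 : Real.exp (2 * B) = Real.exp B ^ 2 := by rw [← Real.exp_nat_mul]; norm_num
    rw [e3, e4]
    nlinarith [mul_nonneg this.le (sq_nonneg (Real.exp A - Real.exp B))]
  have h3 : ∫⁻ g, ENNReal.ofReal
      (Real.exp ((fun i => μ + 4 * g i) ⬝ᵥ (E *ᵥ fun i => μ + 4 * g i) / 2)) ∂gaussianPi k ≤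
      ENNReal.ofReal (Real.exp (μ ^ 2 * (∑ i, ∑ j, E i j) / 2 + δ ^ 2 * (32 * k + 512))) := by
    have hmE32 := measurable_dotProduct_mulVec ((32 : ℝ) • E)
    refine (lintegral_mono hexp).trans ?_
    rw [lintegral_const_mul _ (by fun_prop), lintegral_add_right _ (by fun_prop), hlin]
    refine (mul_le_mul_right (add_le_add_right hq _) _).trans ?_
    rw [← ENNReal.ofReal_add (Real.exp_pos _).le (Real.exp_pos _).le,
      ← ENNReal.ofReal_mul (by positivity)]
    refine ENNReal.ofReal_le_ofReal ?_
    rw [Real.exp_add]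
    have hk : (0 : ℝ) ≤ k := Nat.cast_nonneg k
    have b1 : Real.exp (((8 * μ) • w) ⬝ᵥ ((8 * μ) • w) / 2) ≤
        Real.exp (δ ^ 2 * (32 * k + 512)) := by
      refine Real.exp_le_exp.2 ?_
      simp only [smul_dotProduct, dotProduct_smul, smul_eq_mul]
      nlinarith [mul_le_mul hμ2 hww (dotProduct_self_nonneg w) zero_le_one, sq_nonneg δ]
    have b2 : Real.exp ((32 * δ) ^ 2 / 2) ≤ Real.exp (δ ^ 2 * (32 * k + 512)) := by
      refine Real.exp_le_exp.2 ?_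
      nlinarith [mul_nonneg (sq_nonneg δ) hk]
    have := Real.exp_pos (μ ^ 2 * (∑ i, ∑ j, E i j) / 2)
    nlinarith
  refine h1.trans ((mul_le_mul_right (h2.trans (mul_le_mul_right h3 _)) _).trans ?_)
  rw [mul_left_comm, ← ENNReal.ofReal_mul (Real.exp_pos _).le, ← Real.exp_add]
  refine mul_le_mul_right (ENNReal.ofReal_le_ofReal (Real.exp_le_exp.2 ?_)) _
  nlinarith [sq_nonneg δ]

/-! ### The one-dimensional Gaussian law tilted by a sign. -/

theorem integral_exp_mul_sq_gaussianReal {s : ℝ} (hs : s < 1 / 2) :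
    Integrable (fun u => Real.exp (s * u ^ 2)) (gaussianReal 0 1) ∧
      ∫ u, Real.exp (s * u ^ 2) ∂gaussianReal 0 1 = (Real.sqrt (1 - 2 * s))⁻¹ := by
  have hfun : ∀ u : ℝ, gaussianPDFReal 0 1 u * Real.exp (s * u ^ 2) =
      (Real.sqrt (2 * Real.pi))⁻¹ * Real.exp (-(1 / 2 - s) * u ^ 2) := by
    intro u
    rw [gaussianPDFReal_def, mul_assoc, ← Real.exp_add]
    simp only [NNReal.coe_one, mul_one, sub_zero]
    congr 2; ring
  constructor
  · rw [gaussianReal_of_var_ne_zero 0 one_ne_zero, integrable_withDensity_iff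
      (measurable_gaussianPDF 0 1) (Filter.Eventually.of_forall fun x => gaussianPDF_lt_top)]
    simp only [toReal_gaussianPDF]
    refine ((integrable_exp_neg_mul_sq (b := 1 / 2 - s) (by linarith)).const_mul
      (Real.sqrt (2 * Real.pi))⁻¹).congr (Filter.Eventually.of_forall fun u => ?_)
    simp only
    rw [mul_comm (Real.exp (s * u ^ 2)), hfun]
  · rw [integral_gaussianReal_eq_integral_smul one_ne_zero]
    simp only [smul_eq_mul, hfun]
    rw [integral_const_mul, integral_gaussian, ← Real.sqrt_inv, ← Real.sqrt_mul (by positivity),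
      ← Real.sqrt_inv]
    congr 1
    have : 1 - 2 * s ≠ 0 := by linarith
    have h2 : 1 / 2 - s ≠ 0 := by linarith
    have := Real.pi_ne_zero
    field_simp

theorem measurable_real_sign : Measurable Real.sign := by
  unfold Real.sign
  exact Measurable.ite measurableSet_Iio measurable_const
    (Measurable.ite measurableSet_Ioi measurable_const measurable_const)

theorem abs_real_sign_le (u : ℝ) : |Real.sign u| ≤ 1 := by
  rcases Real.sign_apply_eq u with h | h | h <;> simp [h]

theorem real_sign_mul_self (u : ℝ) : Real.sign u * u = |u| := by
  rcases lt_trichotomy u 0 with h | h | h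
  · rw [Real.sign_of_neg h, abs_of_neg h]; ring
  · simp [h]
  · rw [Real.sign_of_pos h, abs_of_pos h]; ring

theorem one_add_mul_sign_mem {c : ℝ} (hc : |c| ≤ 1 / 2) (u : ℝ) :
    0 ≤ 1 + c * Real.sign u ∧ 1 + c * Real.sign u ≤ 3 / 2 := by
  have h : |c * Real.sign u| ≤ 1 / 2 := by
    rw [abs_mul]
    nlinarith [abs_real_sign_le u, abs_nonneg c, abs_nonneg (Real.sign u)]
  constructor <;> linarith [abs_le.1 h]

/-- The mean of the absolute value of a standard Gaussian variable. -/
noncomputable def gaussianAbsMean : ℝ := ∫ u, |u| ∂gaussianReal 0 1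

theorem integrable_id_gaussian : Integrable (fun u : ℝ => u) (gaussianReal 0 1) := by
  exact (memLp_id_gaussianReal' (μ := 0) (v := 1) 1 (by simp)).integrable le_rfl

theorem gaussianAbsMean_pos : 0 < gaussianAbsMean := by
  rw [gaussianAbsMean, integral_pos_iff_support_of_nonneg (fun u => abs_nonneg u)
    integrable_id_gaussian.abs]
  have : Function.support (fun u : ℝ => |u|) = {0}ᶜ := by ext u; simp
  rw [this, prob_compl_eq_one_sub (measurableSet_singleton 0)]
  have := nullSingletonClass_gaussianReal (μ := 0) (v := 1) one_ne_zero
  simp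

theorem gaussianAbsMean_le_one : gaussianAbsMean ≤ 1 := by
  have hsq : Integrable (fun u : ℝ => u ^ 2) (gaussianReal 0 1) :=
    (memLp_id_gaussianReal' (μ := 0) (v := 1) 2 (by simp)).integrable_sq
  have h1 : ∫ u : ℝ, u ^ 2 ∂gaussianReal 0 1 = 1 := by
    have := variance_of_integral_eq_zero (X := fun u : ℝ => u) (μ := gaussianReal 0 1)
      (by fun_prop) (by simp)
    rw [variance_fun_id_gaussianReal] at this
    simpa using this.symm
  calc gaussianAbsMean ≤ ∫ u, (1 / 2 + (1 / 2) * u ^ 2) ∂gaussianReal 0 1 :=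
        integral_mono integrable_id_gaussian.abs ((integrable_const _).add (hsq.const_mul _))
          fun u => by nlinarith [sq_nonneg (|u| - 1), sq_abs u]
    _ = 1 := by
        rw [integral_add (integrable_const _) (hsq.const_mul _), integral_const_mul, h1]
        simp; norm_num

theorem integral_sign_mul_even (g : ℝ → ℝ) (hg : ∀ u, g (-u) = g u) :
    ∫ u, Real.sign u * g u ∂gaussianReal 0 1 = 0 := by
  have h : ∫ u, Real.sign u * g u ∂gaussianReal 0 1 =
      ∫ u, Real.sign (-u) * g (-u) ∂gaussianReal 0 1 := by
    have hm : (gaussianReal 0 1).map (fun u : ℝ => -u) = gaussianReal 0 1 := by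
      simpa using gaussianReal_map_neg (μ := 0) (v := 1)
    conv_lhs => rw [← hm]
    exact (MeasurableEquiv.neg ℝ).measurableEmbedding.integral_map _
  simp only [Real.sign_neg, hg, neg_mul] at h
  rw [integral_neg] at h
  linarith

/-- The majorant is a linear term plus an even function. A sign tilt of a symmetric law has no
effect on the even part, so it enters only through the mean. -/
theorem exp_le_add_exp_sq (x : ℝ) : Real.exp x ≤ x + Real.exp (x ^ 2) := by
  have h := Real.add_one_le_exp (x ^ 2)
  rcases le_or_gt |x| 1 with h1 | h1
  · have := (abs_le.1 (Real.abs_exp_sub_one_sub_id_le h1)).2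
    linarith
  · rcases lt_abs.1 h1 with h2 | h2
    · have : Real.exp x ≤ Real.exp (x ^ 2) := Real.exp_le_exp.2 (by nlinarith)
      linarith
    · have : Real.exp x ≤ 1 := Real.exp_le_one_iff.2 (by linarith)
      nlinarith

theorem integrable_sign_mul {g : ℝ → ℝ} (hg : Integrable g (gaussianReal 0 1)) :
    Integrable (fun u => Real.sign u * g u) (gaussianReal 0 1) :=
  hg.bdd_mul measurable_real_sign.aestronglyMeasurable
    (Filter.Eventually.of_forall fun u => abs_real_sign_le u)

theorem integrable_tilt_mul (c : ℝ) {g : ℝ → ℝ} (hg : Integrable g (gaussianReal 0 1)) :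
    Integrable (fun u => (1 + c * Real.sign u) * g u) (gaussianReal 0 1) := by
  refine (hg.add ((integrable_sign_mul hg).const_mul c)).congr
    (Filter.Eventually.of_forall fun u => ?_)
  simp only [Pi.add_apply]
  ring

theorem integral_tilt_mul (c : ℝ) {g : ℝ → ℝ} (hg : Integrable g (gaussianReal 0 1)) :
    ∫ u, (1 + c * Real.sign u) * g u ∂gaussianReal 0 1 =
      ∫ u, g u ∂gaussianReal 0 1 + c * ∫ u, Real.sign u * g u ∂gaussianReal 0 1 := by
  rw [← integral_const_mul, ← integral_add hg ((integrable_sign_mul hg).const_mul c)]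
  congr 1; funext u; ring

theorem integral_exp_mul_gaussian (y : ℝ) :
    ∫ u, Real.exp (y * u) ∂gaussianReal 0 1 = Real.exp (y ^ 2 / 2) := by
  have := congrFun (mgf_id_gaussianReal (μ := 0) (v := 1)) y
  simp only [mgf, id_eq] at this
  rw [this]; congr 1; simp

theorem integral_tilt_exp_le_three_halves {c : ℝ} (hc : |c| ≤ 1 / 2) (y : ℝ) :
    ∫ u, (1 + c * Real.sign u) * Real.exp (y * u) ∂gaussianReal 0 1 ≤
      3 / 2 * Real.exp (y ^ 2 / 2) := by
  have hi := integrable_exp_mul_gaussianReal (μ := 0) (v := 1) y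
  rw [← integral_exp_mul_gaussian, ← integral_const_mul]
  exact integral_mono (integrable_tilt_mul c hi) (hi.const_mul _) fun u =>
    mul_le_mul_of_nonneg_right (one_add_mul_sign_mem hc u).2 (Real.exp_pos _).le

/-- The tilted Gaussian law with density `1 + c * sign` is sub-Gaussian around its mean. -/
theorem integral_tilt_exp_le {c : ℝ} (hc : |c| ≤ 1 / 2) (y : ℝ) :
    ∫ u, (1 + c * Real.sign u) * Real.exp (y * u) ∂gaussianReal 0 1 ≤
      Real.exp (c * gaussianAbsMean * y + 4 * y ^ 2) := by
  rcases le_or_gt |y| (1 / 2) with hy | hy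
  · have hy2 : y ^ 2 ≤ 1 / 4 := by rw [← sq_abs]; nlinarith [abs_nonneg y]
    obtain ⟨hi, hI⟩ := integral_exp_mul_sq_gaussianReal (s := y ^ 2) (by linarith)
    have hlin : Integrable (fun u => y * u) (gaussianReal 0 1) := integrable_id_gaussian.const_mul y
    have h1 : ∫ u, (1 + c * Real.sign u) * Real.exp (y * u) ∂gaussianReal 0 1 ≤
        ∫ u, (1 + c * Real.sign u) * (y * u + Real.exp (y ^ 2 * u ^ 2)) ∂gaussianReal 0 1 :=
      integral_mono (integrable_tilt_mul c (integrable_exp_mul_gaussianReal y))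
        (integrable_tilt_mul c (hlin.add hi)) fun u =>
          mul_le_mul_of_nonneg_left (by
            have := exp_le_add_exp_sq (y * u)
            rwa [mul_pow] at this) (one_add_mul_sign_mem hc u).1
    have h2 : ∫ u, (1 + c * Real.sign u) * (y * u + Real.exp (y ^ 2 * u ^ 2)) ∂gaussianReal 0 1 =
        c * gaussianAbsMean * y + (Real.sqrt (1 - 2 * y ^ 2))⁻¹ := by
      have e1 := integral_tilt_mul c hlin
      have e2 := integral_tilt_mul c hi
      rw [integral_sign_mul_even _ fun u => by rw [neg_sq], hI] at e2
      have e3 : ∫ u : ℝ, y * u ∂gaussianReal 0 1 = 0 := by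
        rw [integral_const_mul]
        have := integral_id_gaussianReal (μ := 0) (v := 1)
        rw [this, mul_zero]
      have e4 : ∫ u, Real.sign u * (y * u) ∂gaussianReal 0 1 = y * gaussianAbsMean := by
        rw [gaussianAbsMean, ← integral_const_mul]
        congr 1; funext u; rw [← real_sign_mul_self]; ring
      rw [e3, e4] at e1
      simp_rw [mul_add]
      rw [integral_add (integrable_tilt_mul c hlin) (integrable_tilt_mul c hi), e1, e2]
      ring
    have h3 : (Real.sqrt (1 - 2 * y ^ 2))⁻¹ ≤ 1 + 4 * y ^ 2 := by
      have hpos : 0 < 1 - 2 * y ^ 2 := by linarith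
      rw [inv_le_iff_one_le_mul₀ (Real.sqrt_pos.2 hpos)]
      have := Real.sq_sqrt hpos.le
      set r := Real.sqrt (1 - 2 * y ^ 2)
      have hr : 0 ≤ r := Real.sqrt_nonneg _
      set s := y ^ 2
      have hs0 : 0 ≤ s := sq_nonneg y
      refine le_of_sq_le_sq ?_ (by positivity)
      rw [mul_pow, this]
      nlinarith [mul_nonneg hs0 hs0, mul_le_mul hy2 hy2 hs0 (by norm_num : (0:ℝ) ≤ 1/4)]
    rw [h2] at h1
    refine h1.trans (le_trans ?_ (Real.add_one_le_exp _))
    linarith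
  -- For large `y` the tilt may be bounded by 3/2: the slack `4 y ^ 2 - y ^ 2 - y ^ 2 / 2` absorbs
  -- both this factor and the mean term.
  · refine (integral_tilt_exp_le_three_halves hc y).trans ?_
    have hm := gaussianAbsMean_le_one
    have hm0 := gaussianAbsMean_pos
    have h1 : |c * gaussianAbsMean * y| ≤ y ^ 2 := by
      rw [abs_mul, abs_mul, abs_of_pos hm0, ← sq_abs y]
      have : |c| * gaussianAbsMean ≤ 1 / 2 := by nlinarith [abs_nonneg c]
      nlinarith [abs_nonneg y]
    have h2 : (1 / 4 : ℝ) ≤ y ^ 2 := by rw [← sq_abs]; nlinarith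
    have h3 : (3 / 2 : ℝ) ≤ Real.exp (5 / 2 * y ^ 2) := by
      linarith [Real.add_one_le_exp (5 / 2 * y ^ 2)]
    calc 3 / 2 * Real.exp (y ^ 2 / 2) ≤ Real.exp (5 / 2 * y ^ 2) * Real.exp (y ^ 2 / 2) :=
          mul_le_mul_of_nonneg_right h3 (Real.exp_pos _).le
      _ ≤ _ := by
          rw [← Real.exp_add]
          exact Real.exp_le_exp.2 (by linarith [(abs_le.1 h1).1])

theorem exp_add_mul_abs_le {τ : ℝ} (hτ0 : 0 ≤ τ) (hτ1 : τ ≤ 1) (y u : ℝ) :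
    Real.exp (y * u + τ * |u|) ≤
      Real.exp (y * u) + τ * (Real.exp ((y + 1) * u) + Real.exp ((y - 1) * u)) := by
  have h1 : Real.exp (τ * |u|) ≤ 1 - τ + τ * Real.exp |u| := by
    have := convexOn_exp.2 (Set.mem_univ 0) (Set.mem_univ |u|) (sub_nonneg.2 hτ1) hτ0 (by ring)
    simpa using this
  have h2 : Real.exp |u| ≤ Real.exp u + Real.exp (-u) := by
    rcases abs_choice u with h | h <;> rw [h] <;> linarith [Real.exp_pos u, Real.exp_pos (-u)]
  have h3 : Real.exp ((y + 1) * u) = Real.exp (y * u) * Real.exp u := by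
    rw [← Real.exp_add]; ring_nf
  have h4 : Real.exp ((y - 1) * u) = Real.exp (y * u) * Real.exp (-u) := by
    rw [← Real.exp_add]; ring_nf
  rw [Real.exp_add, h3, h4]
  have := Real.exp_pos (y * u)
  have h5 : Real.exp (τ * |u|) ≤ 1 + τ * (Real.exp u + Real.exp (-u)) := by nlinarith
  nlinarith

/-- The term `τ |u|` pays for replacing the norm of a random vector by its typical value. Convexity
in `τ` reduces it to the exponents `y` and `y ± 1`. -/
theorem lintegral_tilt_exp_abs_le {c : ℝ} (hc : |c| ≤ 1 / 2) {τ : ℝ} (hτ0 : 0 ≤ τ) (hτ1 : τ ≤ 1)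
    (y : ℝ) :
    ∫⁻ u, ENNReal.ofReal ((1 + c * Real.sign u) * Real.exp (y * u + τ * |u|)) ∂gaussianReal 0 1 ≤
      ENNReal.ofReal (Real.exp (c * gaussianAbsMean * y + 4 * y ^ 2 + 10 * τ)) := by
  have hi := fun z : ℝ => integrable_tilt_mul c (integrable_exp_mul_gaussianReal (μ := 0) (v := 1) z)
  have hsum : Integrable (fun u => (1 + c * Real.sign u) * Real.exp (y * u) +
      τ * ((1 + c * Real.sign u) * Real.exp ((y + 1) * u) +
        (1 + c * Real.sign u) * Real.exp ((y - 1) * u))) (gaussianReal 0 1) :=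
    (hi y).add (((hi (y + 1)).add (hi (y - 1))).const_mul τ)
  have hle : ∀ u : ℝ, (1 + c * Real.sign u) * Real.exp (y * u + τ * |u|) ≤
      (1 + c * Real.sign u) * Real.exp (y * u) +
      τ * ((1 + c * Real.sign u) * Real.exp ((y + 1) * u) +
        (1 + c * Real.sign u) * Real.exp ((y - 1) * u)) := by
    intro u
    refine (mul_le_mul_of_nonneg_left (exp_add_mul_abs_le hτ0 hτ1 y u)
      (one_add_mul_sign_mem hc u).1).trans (le_of_eq (by ring))
  refine (lintegral_mono fun u => ENNReal.ofReal_le_ofReal (hle u)).trans ?_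
  rw [← ofReal_integral_eq_lintegral_ofReal hsum (Filter.Eventually.of_forall fun u => by
    have := (one_add_mul_sign_mem hc u).1
    simp only [Pi.zero_apply]
    positivity)]
  refine ENNReal.ofReal_le_ofReal ?_
  have h2 : Integrable (fun u => τ * ((1 + c * Real.sign u) * Real.exp ((y + 1) * u) +
      (1 + c * Real.sign u) * Real.exp ((y - 1) * u))) (gaussianReal 0 1) :=
    ((hi (y + 1)).add (hi (y - 1))).const_mul τ
  rw [integral_add (hi y) h2, integral_const_mul, integral_add (hi _) (hi _)]
  have a0 := integral_tilt_exp_le hc y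
  have a1 := integral_tilt_exp_le_three_halves hc (y + 1)
  have a2 := integral_tilt_exp_le_three_halves hc (y - 1)
  have hm := gaussianAbsMean_le_one
  have hm0 := gaussianAbsMean_pos
  set X := c * gaussianAbsMean * y + 4 * y ^ 2 with hX
  -- The minimum of `3 y ^ 2 - |y| / 2` is `-1/48`. The resulting factor 10/3 for each of the two
  -- shifted exponents, times 3/2, gives the constant 10.
  have hX1 : y ^ 2 + 1 ≤ X + (1 + 1 / 48) := by
    have : |c * gaussianAbsMean * y| ≤ |y| / 2 := by
      rw [abs_mul, abs_mul, abs_of_pos hm0]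
      have : |c| * gaussianAbsMean ≤ 1 / 2 := by nlinarith [abs_nonneg c]
      nlinarith [abs_nonneg y]
    have h3 := (abs_le.1 this).1
    rw [hX, ← sq_abs y]
    nlinarith [sq_nonneg (|y| - 1 / 12)]
  have hE : Real.exp (1 + 1 / 48) ≤ 10 / 3 := by
    have h1 := Real.exp_one_lt_d9
    have h2 : Real.exp (1 / 48) ≤ 48 / 47 := by
      have := Real.one_sub_le_exp_neg (1 / 48)
      rw [Real.exp_neg] at this
      rw [← inv_inv (Real.exp (1 / 48))]
      rw [inv_le_comm₀ (by positivity) (by norm_num)]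
      norm_num at this ⊢; linarith
    rw [Real.exp_add]
    nlinarith [Real.exp_pos 1, Real.exp_pos (1 / 48)]
  have b : ∀ z : ℝ, z ≤ y ^ 2 + 1 → Real.exp z ≤ Real.exp X * (10 / 3) := by
    intro z hz
    refine (Real.exp_le_exp.2 (hz.trans hX1)).trans ?_
    rw [Real.exp_add]
    exact mul_le_mul_of_nonneg_left hE (Real.exp_pos _).le
  have b1 := b ((y + 1) ^ 2 / 2) (by nlinarith [sq_nonneg (y - 1)])
  have b2 := b ((y - 1) ^ 2 / 2) (by nlinarith [sq_nonneg (y + 1)])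
  have b3 : Real.exp X * (1 + 10 * τ) ≤ Real.exp (X + 10 * τ) := by
    rw [Real.exp_add X]
    refine mul_le_mul_of_nonneg_left ?_ (Real.exp_pos _).le
    linarith [Real.add_one_le_exp (10 * τ)]
  refine le_trans ?_ b3
  nlinarith

/-- The supermartingale principle: integrate out the last point repeatedly. It drives both the
clique estimate and the bound for the exceptional event. -/
theorem lintegral_pi_le_of_step {α : Type*} [MeasurableSpace α] (ν : Measure α) [SigmaFinite ν]
    (Φ : ∀ k : ℕ, (Fin k → α) → ℝ≥0∞) (hΦ : ∀ k, Measurable (Φ k)) (m : ℕ)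
    (hstep : ∀ k < m, ∀ x : Fin k → α,
      ∫⁻ y, Φ (k + 1) (Fin.snoc (α := fun _ => α) x y) ∂ν ≤ Φ k x) :
    ∫⁻ x, Φ m x ∂(Measure.pi fun _ : Fin m => ν) ≤ Φ 0 Fin.elim0 := by
  induction m with
  | zero =>
    refine le_of_eq ?_
    rw [lintegral_congr fun x => congrArg (Φ 0) (Subsingleton.elim x Fin.elim0)]
    simp
  | succ m ih =>
    rw [lintegral_pi_snoc _ _ _ (hΦ _)]
    exact (lintegral_mono fun x => hstep m m.lt_succ_self x).trans
      (ih fun k hk => hstep k (hk.trans m.lt_succ_self))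

/-! ### Sums and products over pairs of a tuple. -/

section Pairs

variable {V : Type*} {k : ℕ}

/-- The sum of `g (x i) (x j)` over all pairs `i < j`. -/
def pairSum (g : V → V → ℝ) (x : Fin k → V) : ℝ :=
  ∑ j, ∑ i, if i < j then g (x i) (x j) else 0

/-- The product of `g (x i) (x j)` over all pairs `i < j`. -/
def pairProd (g : V → V → ℝ) (x : Fin k → V) : ℝ :=
  ∏ j, ∏ i, if i < j then g (x i) (x j) else 1

theorem pairSum_snoc (g : V → V → ℝ) (x : Fin k → V) (y : V) :
    pairSum g (Fin.snoc (α := fun _ => V) x y) = pairSum g x + ∑ i, g (x i) y := by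
  have h : ∀ j : Fin k, ¬ Fin.last k < j.castSucc := fun j => not_lt.2 (Fin.le_last _)
  simp [pairSum, Fin.sum_univ_castSucc, Fin.castSucc_lt_last, h]

theorem pairProd_snoc (g : V → V → ℝ) (x : Fin k → V) (y : V) :
    pairProd g (Fin.snoc (α := fun _ => V) x y) = pairProd g x * ∏ i, g (x i) y := by
  have h : ∀ j : Fin k, ¬ Fin.last k < j.castSucc := fun j => not_lt.2 (Fin.le_last _)
  simp [pairProd, Fin.prod_univ_castSucc, Fin.castSucc_lt_last, h]

theorem pairProd_nonneg {g : V → V → ℝ} (hg : ∀ a b, 0 ≤ g a b) (x : Fin k → V) :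
    0 ≤ pairProd g x :=
  prod_nonneg fun j _ => prod_nonneg fun i _ => by split_ifs <;> simp [hg]

theorem pairProd_le_one {g : V → V → ℝ} (hg : ∀ a b, 0 ≤ g a b) (hg1 : ∀ a b, g a b ≤ 1)
    (x : Fin k → V) : pairProd g x ≤ 1 := by
  refine prod_le_one (fun j _ => prod_nonneg fun i _ => ?_)
    fun j _ => prod_le_one (fun i _ => ?_) fun i _ => ?_
  all_goals split_ifs <;> simp [hg, hg1]

theorem pairProd_const_mul (a : ℝ) (g : V → V → ℝ) (x : Fin k → V) :
    pairProd (fun u v => a * g u v) x = a ^ (k.choose 2) * pairProd g x := by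
  have h : ∀ i j : Fin k, (if i < j then a * g (x i) (x j) else 1) =
      (if i < j then a else 1) * (if i < j then g (x i) (x j) else 1) := by
    intro i j; split_ifs <;> simp
  simp_rw [pairProd, h, prod_mul_distrib]
  congr 1
  have h2 : ∀ j : Fin k, (∏ i : Fin k, if i < j then a else 1) = a ^ (j : ℕ) := by
    intro j
    rw [← prod_filter, prod_const]
    congr 1
    have : univ.filter (fun i : Fin k => i < j) = Finset.Iio j := by ext; simp
    rw [this, Fin.card_Iio]
  simp_rw [h2]
  rw [prod_pow_eq_pow_sum, Fin.sum_univ_eq_sum_range (fun i => i), Finset.sum_range_id,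
    Nat.choose_two_right]

theorem sum_off_diagonal_eq_two_mul_pairSum (g : V → V → ℝ) (hg : ∀ a b, g a b = g b a)
    (x : Fin k → V) : ∑ i, ∑ j, (if i = j then 0 else g (x i) (x j)) = 2 * pairSum g x := by
  have h : ∀ i j : Fin k, (if i = j then 0 else g (x i) (x j)) =
      (if i < j then g (x i) (x j) else 0) + (if j < i then g (x j) (x i) else 0) := by
    intro i j
    rcases lt_trichotomy i j with h | h | h
    · simp [h, h.ne, h.not_gt]
    · simp [h]
    · simp [h, h.ne', h.not_gt, hg (x i)]
  simp_rw [h, sum_add_distrib]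
  rw [sum_comm, two_mul]
  rfl

variable [MeasurableSpace V]

theorem measurable_pairSum {g : V → V → ℝ} (hg : Measurable (Function.uncurry g)) :
    Measurable (pairSum (k := k) g) := by
  refine Finset.measurable_fun_sum _ fun j _ => Finset.measurable_fun_sum _ fun i _ => ?_
  split_ifs
  · exact hg.comp (f := fun x : Fin k → V => (x i, x j)) (by fun_prop)
  · exact measurable_const

theorem measurable_pairProd {g : V → V → ℝ} (hg : Measurable (Function.uncurry g)) :
    Measurable (pairProd (k := k) g) := by
  refine Finset.measurable_fun_prod _ fun j _ => Finset.measurable_fun_prod _ fun i _ => ?_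
  split_ifs
  · exact hg.comp (f := fun x : Fin k → V => (x i, x j)) (by fun_prop)
  · exact measurable_const

end Pairs

/-! ### Almost orthogonal tuples and their Gram matrices. -/

section AlmostOrthogonal

variable {V : Type*} [NormedAddCommGroup V] [InnerProductSpace ℝ V]

/-- The direction of a vector. -/
noncomputable def direction (x : V) : V := ‖x‖⁻¹ • x

theorem norm_direction {x : V} (hx : x ≠ 0) : ‖direction x‖ = 1 := by
  rw [direction, norm_smul, norm_inv, norm_norm, inv_mul_cancel₀ (norm_ne_zero_iff.2 hx)]

theorem inner_direction_direction (x y : V) :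
    inner ℝ (direction x) (direction y) = inner ℝ (direction x) y / ‖y‖ := by
  rw [direction, direction, real_inner_smul_right, div_eq_inv_mul]

/-- The vectors `x i` have norms close to `r` and are almost orthogonal in the mean square sense. -/
def AlmostOrthogonal (r δ : ℝ) {k : ℕ} (x : Fin k → V) : Prop :=
  (∀ j, |‖x j‖ - r| ≤ δ * r) ∧
    pairSum (fun a b => inner ℝ (direction a) b ^ 2) x ≤ δ ^ 2 * r ^ 2 / 4

/-- The summands are squares, so the condition passes to prefixes, and vectors can be integrated out
from the end without leaving the event. -/
theorem AlmostOrthogonal.of_snoc {r δ : ℝ} {k : ℕ} {x : Fin k → V} {y : V}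
    (h : AlmostOrthogonal r δ (Fin.snoc (α := fun _ => V) x y)) :
    AlmostOrthogonal r δ x ∧ |‖y‖ - r| ≤ δ * r := by
  refine ⟨⟨fun j => by simpa using h.1 j.castSucc, ?_⟩, by simpa using h.1 (Fin.last k)⟩
  have h2 := h.2
  rw [pairSum_snoc] at h2
  have : 0 ≤ ∑ i, inner ℝ (direction (x i)) y ^ 2 := sum_nonneg fun i _ => sq_nonneg _
  linarith

/-- The off-diagonal part of the Gram matrix of the directions. -/
noncomputable def gramOff {k : ℕ} (x : Fin k → V) : Matrix (Fin k) (Fin k) ℝ :=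
  Matrix.of fun i j => if i = j then 0 else inner ℝ (direction (x i)) (direction (x j))

theorem gramOff_isHermitian {k : ℕ} (x : Fin k → V) : (gramOff x).IsHermitian := by
  refine IsHermitian.ext fun i j => ?_
  simp only [gramOff, of_apply, star_trivial, eq_comm (a := j), real_inner_comm]

theorem sum_gramOff {k : ℕ} (x : Fin k → V) : ∑ i, ∑ j, gramOff x i j =
    2 * pairSum (fun a b => inner ℝ (direction a) (direction b)) x := by
  rw [← sum_off_diagonal_eq_two_mul_pairSum _ fun a b => real_inner_comm _ _]
  rfl

theorem AlmostOrthogonal.norm_bounds {r δ t : ℝ} (h : |t - r| ≤ δ * r) :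
    (1 - δ) * r ≤ t ∧ t ≤ (1 + δ) * r := by
  have := abs_le.1 h
  constructor <;> linarith

theorem AlmostOrthogonal.ne_zero {r δ : ℝ} (hr : 0 < r) (hδ : δ ≤ 1 / 4) {k : ℕ} {x : Fin k → V}
    (h : AlmostOrthogonal r δ x) (i : Fin k) : x i ≠ 0 := by
  have := (AlmostOrthogonal.norm_bounds (h.1 i)).1
  rw [← norm_pos_iff]
  nlinarith

theorem AlmostOrthogonal.one_add_gramOff {r δ : ℝ} (hr : 0 < r) (hδ : δ ≤ 1 / 4) {k : ℕ}
    {x : Fin k → V} (h : AlmostOrthogonal r δ x) (i j : Fin k) :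
    (1 + gramOff x) i j = inner ℝ (direction (x i)) (direction (x j)) := by
  by_cases hij : i = j
  · subst hij
    simp [gramOff, norm_direction (h.ne_zero hr hδ i)]
  · simp [gramOff, hij]

/-- Normalising the later vector costs a factor `16 / (9 r ^ 2)`. Counting each pair twice gives
`8/9 * δ ^ 2`, which is why the definition has the factor 1/4. -/
theorem AlmostOrthogonal.sum_gramOff_sq_le {r δ : ℝ} (hr : 0 < r) (hδ : δ ≤ 1 / 4) {k : ℕ}
    {x : Fin k → V} (h : AlmostOrthogonal r δ x) : ∑ i, ∑ j, gramOff x i j ^ 2 ≤ δ ^ 2 := by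
  have h1 : ∑ i, ∑ j, gramOff x i j ^ 2 =
      2 * pairSum (fun a b => inner ℝ (direction a) (direction b) ^ 2) x := by
    rw [← sum_off_diagonal_eq_two_mul_pairSum _ fun a b => by rw [real_inner_comm]]
    refine sum_congr rfl fun i _ => sum_congr rfl fun j _ => ?_
    simp only [gramOff, of_apply]
    split_ifs <;> simp
  have h2 : pairSum (fun a b => inner ℝ (direction a) (direction b) ^ 2) x ≤
      (16 / (9 * r ^ 2)) * pairSum (fun a b => inner ℝ (direction a) b ^ 2) x := by
    simp only [pairSum, mul_sum]
    refine sum_le_sum fun j _ => sum_le_sum fun i _ => ?_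
    split_ifs with hij
    · rw [inner_direction_direction, div_pow, div_eq_inv_mul]
      refine mul_le_mul_of_nonneg_right ?_ (sq_nonneg _)
      have hn := (AlmostOrthogonal.norm_bounds (h.1 j)).1
      have hn' : 3 / 4 * r ≤ ‖x j‖ := by nlinarith
      have hpos : 0 < ‖x j‖ := by linarith
      rw [inv_le_comm₀ (by positivity) (by positivity), inv_div]
      nlinarith
    · simp
  rw [h1]
  have h3 := mul_le_mul_of_nonneg_left h.2 (show 0 ≤ 16 / (9 * r ^ 2) by positivity)
  have h4 : 16 / (9 * r ^ 2) * (δ ^ 2 * r ^ 2 / 4) = 4 / 9 * δ ^ 2 := by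
    field_simp; ring
  nlinarith [sq_nonneg δ]

variable [FiniteDimensional ℝ V] [MeasurableSpace V] [BorelSpace V]

theorem measurable_inner_direction :
    Measurable fun p : V × V => (inner ℝ (direction p.1) p.2 : ℝ) := by
  have : (fun p : V × V => (inner ℝ (direction p.1) p.2 : ℝ)) =
      fun p => ‖p.1‖⁻¹ * inner ℝ p.1 p.2 := by
    funext p; rw [direction, real_inner_smul_left]
  rw [this]
  exact (measurable_fst.norm.inv).mul continuous_inner.measurable

theorem measurable_inner_direction_direction :
    Measurable fun p : V × V => (inner ℝ (direction p.1) (direction p.2) : ℝ) := by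
  simp_rw [inner_direction_direction]
  exact measurable_inner_direction.div measurable_snd.norm

theorem measurableSet_almostOrthogonal (r δ : ℝ) (k : ℕ) :
    MeasurableSet {x : Fin k → V | AlmostOrthogonal r δ x} := by
  have h1 : MeasurableSet {x : Fin k → V | ∀ j, |‖x j‖ - r| ≤ δ * r} := by
    rw [Set.ofPred_forall]
    exact MeasurableSet.iInter fun j => measurableSet_le (by fun_prop) measurable_const
  exact h1.inter (measurableSet_le
    (measurable_pairSum (measurable_inner_direction.pow_const 2)) measurable_const)

end AlmostOrthogonal

/-! ### The expected clique weight on the almost orthogonal event. -/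

section CliqueRecursion

variable {V : Type*} [NormedAddCommGroup V] [InnerProductSpace ℝ V]

/-- The weight of a pair of vectors, which depends only on the sign of their inner product. -/
noncomputable def signWeight (c : ℝ) (a b : V) : ℝ := 1 + c * Real.sign (inner ℝ a b)

theorem signWeight_symm (c : ℝ) (a b : V) : signWeight c a b = signWeight c b a := by
  rw [signWeight, signWeight, real_inner_comm]

theorem real_sign_mul_of_pos {a : ℝ} (ha : 0 < a) (u : ℝ) : Real.sign (a * u) = Real.sign u := by
  rcases lt_trichotomy u 0 with h | h | h
  · rw [Real.sign_of_neg h, Real.sign_of_neg (mul_neg_of_pos_of_neg ha h)]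
  · simp [h]
  · rw [Real.sign_of_pos h, Real.sign_of_pos (mul_pos ha h)]

theorem signWeight_eq_direction (c : ℝ) {a : V} (ha : a ≠ 0) (b : V) :
    signWeight c a b = 1 + c * Real.sign (inner ℝ (direction a) b) := by
  rw [signWeight, direction, real_inner_smul_left,
    real_sign_mul_of_pos (inv_pos.2 (norm_pos_iff.2 ha))]

/-- Replacing `1 / ‖y‖` by `1 / r` makes the exponent linear in the Gaussian variable, up to the
stated multiple of its absolute value. -/
theorem exp_inner_direction_le {r δ s : ℝ} (hr : 0 < r) (hδ0 : 0 ≤ δ) (hδ : δ ≤ 1 / 4)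
    (hs : 0 ≤ s) {y : V} (hy : |‖y‖ - r| ≤ δ * r) (a : V) :
    s * inner ℝ (direction a) (direction y) ≤
      s / r * inner ℝ (direction a) y + 2 * δ * (s / r) * |inner ℝ (direction a) y| := by
  obtain ⟨h1, h2⟩ := AlmostOrthogonal.norm_bounds hy
  have hn : 3 / 4 * r ≤ ‖y‖ := by nlinarith
  have hpos : 0 < ‖y‖ := by nlinarith
  rw [inner_direction_direction]
  set u : ℝ := inner ℝ (direction a) y
  have h3 : |1 / ‖y‖ - 1 / r| ≤ 2 * δ / r := by
    rw [div_sub_div _ _ hpos.ne' hr.ne', abs_div, abs_of_pos (mul_pos hpos hr),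
      div_le_div_iff₀ (mul_pos hpos hr) hr, one_mul, mul_one, abs_sub_comm]
    calc |‖y‖ - r| * r ≤ δ * r * r := mul_le_mul_of_nonneg_right hy hr.le
      _ ≤ _ := by nlinarith [mul_nonneg hδ0 hr.le, mul_nonneg (mul_nonneg hδ0 hr.le) hr.le]
  have h4 : u * (1 / ‖y‖ - 1 / r) ≤ |u| * (2 * δ / r) :=
    (le_abs_self _).trans (by rw [abs_mul]; exact mul_le_mul_of_nonneg_left h3 (abs_nonneg u))
  have h5 := mul_le_mul_of_nonneg_left h4 hs
  calc s * (u / ‖y‖) = s * (u * (1 / ‖y‖ - 1 / r)) + s / r * u := by field_simp; ring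
    _ ≤ s * (|u| * (2 * δ / r)) + s / r * u := by linarith
    _ = _ := by field_simp; ring

variable [FiniteDimensional ℝ V] [MeasurableSpace V] [BorelSpace V]

theorem measurable_signWeight (c : ℝ) : Measurable (Function.uncurry (signWeight (V := V) c)) :=
  ((measurable_real_sign.comp continuous_inner.measurable).const_mul c).const_add 1

/-- This is the sub-Gaussian bound at `y + t`, with `4 (y + t) ^ 2 ≤ 8 y ^ 2 + 8 t ^ 2`; the
absolute value adds `20 δ t`, hence 28. The surviving factor `exp (c μ t)`, with `μ` the mean
absolute value, is the source of the cubic term. -/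
theorem lintegral_tilt_abs_exp_le {c : ℝ} (hc : |c| ≤ 1 / 2) {δ t : ℝ} (hδ0 : 0 ≤ δ)
    (hδ : δ ≤ 1 / 4) (ht0 : 0 ≤ t) (ht : t ≤ δ) (y : ℝ) :
    ∫⁻ u, ENNReal.ofReal ((1 + c * Real.sign u) * Real.exp (t * u + 2 * δ * t * |u|)) *
        ENNReal.ofReal (Real.exp (y * u)) ∂gaussianReal 0 1 ≤
      ENNReal.ofReal (Real.exp (c * gaussianAbsMean * t + 28 * δ ^ 2)) *
        ENNReal.ofReal (Real.exp (c * gaussianAbsMean * y + 8 * y ^ 2)) := by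
  have h := lintegral_tilt_exp_abs_le hc (τ := 2 * δ * t) (by positivity) (by nlinarith) (y + t)
  rw [← ENNReal.ofReal_mul (Real.exp_pos _).le, ← Real.exp_add]
  refine le_trans (le_of_eq (lintegral_congr fun u => ?_)) (h.trans
    (ENNReal.ofReal_le_ofReal (Real.exp_le_exp.2 ?_)))
  · rw [← ENNReal.ofReal_mul (mul_nonneg (one_add_mul_sign_mem hc u).1 (Real.exp_pos _).le),
      mul_assoc, ← Real.exp_add]
    congr 3; ring
  · nlinarith [sq_nonneg (y - t)]

theorem abs_mul_gaussianAbsMean_le {c : ℝ} (hc : |c| ≤ 1 / 2) : |c * gaussianAbsMean| ≤ 1 := by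
  rw [abs_mul, abs_of_pos gaussianAbsMean_pos]
  nlinarith [gaussianAbsMean_le_one, gaussianAbsMean_pos, abs_nonneg c]

/-- One step of the estimate for the expected clique weight: integrating out the last vector. -/
theorem lintegral_clique_step {c : ℝ} (hc : |c| ≤ 1 / 2) {r δ s : ℝ} (hr : 0 < r) (hδ0 : 0 ≤ δ)
    (hδ : δ ≤ 1 / 128) (hs0 : 0 ≤ s) (hs : s ≤ δ * r) {k : ℕ} {x : Fin k → V}
    (hx : AlmostOrthogonal r δ x) :
    ∫⁻ y, ENNReal.ofReal ({y : V | |‖y‖ - r| ≤ δ * r}.indicator (fun y => ∏ i,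
        (signWeight c (x i) y * Real.exp (s * inner ℝ (direction (x i)) (direction y)))) y)
        ∂stdGaussian V ≤
      ENNReal.ofReal (Real.exp (k * (c * gaussianAbsMean * (s / r)) +
        (c * gaussianAbsMean) ^ 2 * pairSum (fun a b => inner ℝ (direction a) (direction b)) x +
        600 * δ ^ 2 * (1 + k))) := by
  have ht : s / r ≤ δ := (div_le_iff₀ hr).2 hs
  have hδ4 : δ ≤ 1 / 4 := by linarith
  have h := lintegral_prod_inner_le (fun i => direction (x i)) (gramOff x) (gramOff_isHermitian x)
    (fun i => by simp [gramOff]) (hx.one_add_gramOff hr hδ4) hδ0 hδ (hx.sum_gramOff_sq_le hr hδ4)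
    (fun u => ENNReal.ofReal ((1 + c * Real.sign u) *
      Real.exp (s / r * u + 2 * δ * (s / r) * |u|)))
    (by have := measurable_real_sign; fun_prop) _ (abs_mul_gaussianAbsMean_le hc)
    (lintegral_tilt_abs_exp_le hc hδ0 hδ4 (by positivity) ht)
  rw [sum_gramOff, ← ENNReal.ofReal_pow (Real.exp_pos _).le, ← ENNReal.ofReal_mul (by positivity),
    ← Real.exp_nat_mul, ← Real.exp_add] at h
  refine le_trans (lintegral_mono fun y => ?_) (h.trans
    (ENNReal.ofReal_le_ofReal (Real.exp_le_exp.2 ?_)))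
  · rw [← ENNReal.ofReal_prod_of_nonneg fun i _ =>
      mul_nonneg (one_add_mul_sign_mem hc _).1 (Real.exp_pos _).le]
    refine ENNReal.ofReal_le_ofReal ?_
    by_cases hy : y ∈ {y : V | |‖y‖ - r| ≤ δ * r}
    · rw [Set.indicator_of_mem hy]
      refine prod_le_prod (fun i _ => ?_) fun i _ => ?_
      · exact mul_nonneg (one_add_mul_sign_mem hc _).1 (Real.exp_pos _).le
      · rw [signWeight_eq_direction c (hx.ne_zero hr hδ4 i)]
        exact mul_le_mul_of_nonneg_left (Real.exp_le_exp.2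
          (exp_inner_direction_le hr hδ0 hδ4 hs0 hy _)) (one_add_mul_sign_mem hc _).1
    · rw [Set.indicator_of_notMem hy]
      exact prod_nonneg fun i _ => mul_nonneg (one_add_mul_sign_mem hc _).1 (Real.exp_pos _).le
  · have hk : (0 : ℝ) ≤ k := Nat.cast_nonneg k
    nlinarith [mul_nonneg (sq_nonneg δ) hk, sq_nonneg δ]

theorem sum_range_mul_sub (a : ℝ) (N : ℕ) : ∑ i ∈ range N, (i * (a - 1 - i) : ℝ) =
    (a - 1) * (N * (N - 1) / 2) - (N - 1) * N * (2 * N - 1) / 6 := by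
  induction N with
  | zero => simp
  | succ N ih => rw [sum_range_succ, ih]; push_cast; ring

theorem sum_range_one_add (N : ℕ) : ∑ i ∈ range N, (1 + i : ℝ) = N * (N + 1) / 2 := by
  induction N with
  | zero => simp
  | succ N ih => rw [sum_range_succ, ih]; push_cast; ring

/-- The expected clique weight on the event that the vectors are almost orthogonal. -/
theorem lintegral_clique_almostOrthogonal_le {c : ℝ} (hc : |c| ≤ 1 / 2) {r δ : ℝ} (hr : 0 < r)
    (hδ0 : 0 ≤ δ) (hδ : δ ≤ 1 / 128) (m : ℕ) (hm : (m : ℝ) ≤ δ * r) :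
    ∫⁻ x in {x : Fin m → V | AlmostOrthogonal r δ x},
        ENNReal.ofReal (pairProd (signWeight c) x) ∂(Measure.pi fun _ => stdGaussian V) ≤
      ENNReal.ofReal (Real.exp ((c * gaussianAbsMean) ^ 3 * (m * (m - 1) * (m - 2) / 6) / r +
        600 * δ ^ 2 * m ^ 2)) := by
  set μ := c * gaussianAbsMean with hμ
  have hμ1 : |μ| ≤ 1 := abs_mul_gaussianAbsMean_le hc
  have hμ2 : μ ^ 2 ≤ 1 := by rw [← sq_abs]; nlinarith [abs_nonneg μ]
  -- `T i` is the cost of integrating out a vector with `i` predecessors and `m - 1 - i` successors.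
  -- The products `i * (m - 1 - i)` count triples by their middle vertex and sum to `m choose 3`.
  set T : ℕ → ℝ := fun i => μ ^ 3 / r * (i * (m - 1 - i)) + 600 * δ ^ 2 * (1 + i) with hT
  set e : V → V → ℝ := fun a b => inner ℝ (direction a) (direction b) with he
  -- Each of the `m - k` vectors already integrated out has left behind one copy of `μ ^ 2` times
  -- the sum of the cosines of the remaining pairs.
  set Φ : ∀ k : ℕ, (Fin k → V) → ℝ≥0∞ := fun k x =>
    {x : Fin k → V | AlmostOrthogonal r δ x}.indicator (fun x => ENNReal.ofReal
      (pairProd (signWeight c) x * Real.exp (μ ^ 2 * (m - k) * pairSum e x +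
        ∑ i ∈ Ico k m, T i))) x with hΦ
  have hΦm : ∀ k, Measurable (Φ k) := by
    intro k
    have h1 := measurable_pairProd (k := k) (measurable_signWeight (V := V) c)
    have h2 := measurable_pairSum (k := k) (g := e) (measurable_inner_direction_direction (V := V))
    exact Measurable.indicator (by fun_prop) (measurableSet_almostOrthogonal r δ k)
  have hw : ∀ a b : V, 0 ≤ signWeight c a b := fun a b => (one_add_mul_sign_mem hc _).1
  have hstep : ∀ k < m, ∀ x : Fin k → V,
      ∫⁻ y, Φ (k + 1) (Fin.snoc (α := fun _ => V) x y) ∂stdGaussian V ≤ Φ k x := by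
    intro k hk x
    have hkm : (k : ℝ) + 1 ≤ m := by exact_mod_cast hk
    by_cases hx : AlmostOrthogonal r δ x
    · set s := μ ^ 2 * (m - (k + 1 : ℕ)) with hs
      have hs0 : 0 ≤ s := mul_nonneg (sq_nonneg _) (by push_cast; linarith)
      have hs1 : s ≤ δ * r := by
        refine le_trans ?_ hm
        have : (m : ℝ) - (k + 1 : ℕ) ≤ m := by push_cast; linarith [Nat.cast_nonneg (α := ℝ) k]
        have h0 : (0 : ℝ) ≤ (m : ℝ) - (k + 1 : ℕ) := by push_cast; linarith
        nlinarith
      have hmain := lintegral_clique_step (V := V) hc hr hδ0 hδ hs0 hs1 hx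
      set A := pairProd (signWeight c) x * Real.exp (s * pairSum e x + ∑ i ∈ Ico (k + 1) m, T i)
        with hA
      have hA0 : 0 ≤ A := mul_nonneg (pairProd_nonneg hw x) (Real.exp_pos _).le
      have hle : ∀ y, Φ (k + 1) (Fin.snoc (α := fun _ => V) x y) ≤ ENNReal.ofReal A *
          ENNReal.ofReal ({y : V | |‖y‖ - r| ≤ δ * r}.indicator (fun y => ∏ i,
            (signWeight c (x i) y * Real.exp (s * inner ℝ (direction (x i)) (direction y)))) y) := by
        intro y
        by_cases hy : AlmostOrthogonal r δ (Fin.snoc (α := fun _ => V) x y)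
        · simp only [hΦ]
          rw [Set.indicator_of_mem (show _ ∈ {x | AlmostOrthogonal r δ x} from hy),
            Set.indicator_of_mem (show y ∈ {y : V | |‖y‖ - r| ≤ δ * r} from hy.of_snoc.2),
            ← ENNReal.ofReal_mul hA0, pairProd_snoc, pairSum_snoc]
          refine ENNReal.ofReal_le_ofReal (le_of_eq ?_)
          rw [hA, prod_mul_distrib, ← Real.exp_sum, ← mul_sum, ← hs]
          rw [show s * (pairSum e x + ∑ i, e (x i) y) + ∑ i ∈ Ico (k + 1) m, T i =
            (s * pairSum e x + ∑ i ∈ Ico (k + 1) m, T i) + s * ∑ i, e (x i) y by ring,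
            Real.exp_add]
          ring
        · simp only [hΦ]
          rw [Set.indicator_of_notMem (show _ ∉ {x | AlmostOrthogonal r δ x} from hy)]
          exact zero_le
      refine (lintegral_mono hle).trans ?_
      rw [lintegral_const_mul' _ _ ENNReal.ofReal_ne_top]
      refine (mul_le_mul_right hmain _).trans ?_
      simp only [hΦ]
      rw [Set.indicator_of_mem (show x ∈ {x | AlmostOrthogonal r δ x} from hx),
        ← ENNReal.ofReal_mul hA0, hA, mul_assoc, ← Real.exp_add]
      refine ENNReal.ofReal_le_ofReal (le_of_eq ?_)
      rw [Finset.sum_eq_sum_Ico_succ_bot hk]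
      congr 2
      simp only [hT, hs]
      push_cast
      field_simp
      ring
    · refine le_trans (le_of_eq ?_) zero_le
      rw [← lintegral_zero (μ := stdGaussian V)]
      refine lintegral_congr fun y => ?_
      have hy : Fin.snoc (α := fun _ => V) x y ∉
          {x : Fin (k + 1) → V | AlmostOrthogonal r δ x} :=
        fun h => hx (AlmostOrthogonal.of_snoc h).1
      simp only [hΦ]
      rw [Set.indicator_of_notMem hy]
  have hfin := lintegral_pi_le_of_step (stdGaussian V) Φ hΦm m hstep
  have hlhs : ∫⁻ x in {x : Fin m → V | AlmostOrthogonal r δ x},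
        ENNReal.ofReal (pairProd (signWeight c) x) ∂(Measure.pi fun _ => stdGaussian V) =
      ∫⁻ x, Φ m x ∂(Measure.pi fun _ => stdGaussian V) := by
    rw [← lintegral_indicator (measurableSet_almostOrthogonal r δ m)]
    simp [hΦ]
  rw [hlhs]
  refine hfin.trans ((Set.indicator_le_self _ _ _).trans (ENNReal.ofReal_le_ofReal ?_))
  have hsum : ∑ i ∈ Ico 0 m, T i ≤ μ ^ 3 * (m * (m - 1) * (m - 2) / 6) / r +
      600 * δ ^ 2 * m ^ 2 := by
    rw [← Finset.range_eq_Ico]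
    simp only [hT]
    rw [sum_add_distrib, ← mul_sum, ← mul_sum, sum_range_mul_sub, sum_range_one_add]
    refine add_le_add (le_of_eq (by field_simp; ring)) (mul_le_mul_of_nonneg_left ?_ (by positivity))
    have : (m : ℝ) ≤ m ^ 2 := by exact_mod_cast Nat.le_self_pow two_ne_zero m
    nlinarith
  simpa [pairProd, pairSum] using hsum

end CliqueRecursion

/-! ### Concentration of norms and probability of the exceptional event. -/

theorem lintegral_exp_mul_sq_gaussianReal {s : ℝ} (hs : s < 1 / 2) :
    ∫⁻ u, ENNReal.ofReal (Real.exp (s * u ^ 2)) ∂gaussianReal 0 1 =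
      ENNReal.ofReal (Real.sqrt (1 - 2 * s))⁻¹ := by
  obtain ⟨hi, hI⟩ := integral_exp_mul_sq_gaussianReal hs
  rw [← hI, ofReal_integral_eq_lintegral_ofReal hi
    (Filter.Eventually.of_forall fun x => (Real.exp_pos _).le)]

theorem lintegral_exp_mul_dotProduct_self {s : ℝ} (hs : s < 1 / 2) (k : ℕ) :
    ∫⁻ u, ENNReal.ofReal (Real.exp (s * (u ⬝ᵥ u))) ∂gaussianPi k =
      ENNReal.ofReal ((Real.sqrt (1 - 2 * s))⁻¹) ^ k := by
  have : ∀ u : Fin k → ℝ, ENNReal.ofReal (Real.exp (s * (u ⬝ᵥ u))) =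
      ∏ i, ENNReal.ofReal (Real.exp (s * u i ^ 2)) := by
    intro u
    rw [← ENNReal.ofReal_prod_of_nonneg fun i _ => (Real.exp_pos _).le, ← Real.exp_sum, dotProduct,
      mul_sum]
    simp_rw [sq]
  simp_rw [this]
  rw [lintegral_pi_prod _ _ (fun _ t => ENNReal.ofReal (Real.exp (s * t ^ 2))) (by fun_prop)]
  simp [lintegral_exp_mul_sq_gaussianReal hs]

theorem inv_sqrt_one_sub_le {s : ℝ} (hs : |s| ≤ 1 / 8) :
    (Real.sqrt (1 - 2 * s))⁻¹ ≤ Real.exp (s + 2 * s ^ 2) := by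
  have h1 := exp_sub_sq_le_one_add (t := -2 * s) (by rw [abs_mul]; norm_num; linarith)
  have h2 : Real.exp (-(s + 2 * s ^ 2)) ≤ Real.sqrt (1 - 2 * s) := by
    refine Real.le_sqrt_of_sq_le ?_
    rw [← Real.exp_nat_mul]
    refine le_trans (le_of_eq ?_) (h1.trans (le_of_eq (by ring)))
    congr 1; push_cast; ring
  rw [inv_le_comm₀ (lt_of_lt_of_le (Real.exp_pos _) h2) (Real.exp_pos _), ← Real.exp_neg]
  exact h2

theorem lintegral_exp_mul_norm_sq_le {s : ℝ} (hs : |s| ≤ 1 / 8) (d : ℕ) :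
    ∫⁻ x, ENNReal.ofReal (Real.exp (s * ‖x‖ ^ 2)) ∂stdGaussian (EuclideanSpace ℝ (Fin d)) ≤
      ENNReal.ofReal (Real.exp (d * (s + 2 * s ^ 2))) := by
  rw [← map_pi_eq_stdGaussian, lintegral_map (by fun_prop) (by fun_prop)]
  have h : ∀ u : Fin d → ℝ, ‖(WithLp.toLp 2 u : EuclideanSpace ℝ (Fin d))‖ ^ 2 = u ⬝ᵥ u := by
    intro u
    rw [EuclideanSpace.real_norm_sq_eq, dotProduct]
    simp [sq]
  simp_rw [h]
  rw [lintegral_exp_mul_dotProduct_self (by linarith [(abs_le.1 hs).2]), Real.exp_nat_mul,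
    ENNReal.ofReal_pow (Real.exp_pos _).le]
  gcongr
  exact inv_sqrt_one_sub_le hs

/-- Concentration of the norm of a standard Gaussian vector. -/
theorem stdGaussian_norm_deviation_le (d : ℕ) {δ : ℝ} (hδ0 : 0 ≤ δ) (hδ : δ ≤ 1 / 4) :
    stdGaussian (EuclideanSpace ℝ (Fin d))
      {x | ¬ |‖x‖ - Real.sqrt d| ≤ δ * Real.sqrt d} ≤
      ENNReal.ofReal (2 * Real.exp (-(δ ^ 2 * d / 8))) := by
  set r := Real.sqrt d with hr
  have hr0 : 0 ≤ r := Real.sqrt_nonneg _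
  have hrd : r ^ 2 = d := Real.sq_sqrt (Nat.cast_nonneg d)
  -- Chernoff bound for both tails at once, one for each sign of `s`: at `|s| = δ / 4` the exponent
  -- `2 s ^ 2 - |s| δ` attains its minimum `-δ ^ 2 / 8`.
  have key : ∀ s : ℝ, |s| = δ / 4 → stdGaussian (EuclideanSpace ℝ (Fin d))
      {x | s * d + |s| * δ * d ≤ s * ‖x‖ ^ 2} ≤ ENNReal.ofReal (Real.exp (-(δ ^ 2 * d / 8))) := by
    intro s hs
    set E := EuclideanSpace ℝ (Fin d)
    have hM := mul_meas_ge_le_lintegral (μ := stdGaussian E)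
      (f := fun x : E => ENNReal.ofReal (Real.exp (s * ‖x‖ ^ 2))) (by fun_prop)
      (ENNReal.ofReal (Real.exp (s * d + |s| * δ * d)))
    have hM2 := hM.trans (lintegral_exp_mul_norm_sq_le (s := s) (by rw [hs]; linarith) d)
    have hset : {x : E | s * d + |s| * δ * d ≤ s * ‖x‖ ^ 2} ⊆
        {x : E | ENNReal.ofReal (Real.exp (s * d + |s| * δ * d)) ≤
          ENNReal.ofReal (Real.exp (s * ‖x‖ ^ 2))} :=
      fun x hx => ENNReal.ofReal_le_ofReal (Real.exp_le_exp.2 hx)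
    refine (measure_mono hset).trans ?_
    have h0 : ENNReal.ofReal (Real.exp (-(s * d + |s| * δ * d))) *
        ENNReal.ofReal (Real.exp (s * d + |s| * δ * d)) = 1 := by
      rw [← ENNReal.ofReal_mul (Real.exp_pos _).le, ← Real.exp_add]; simp
    have h3 := mul_le_mul_right hM2 (ENNReal.ofReal (Real.exp (-(s * d + |s| * δ * d))))
    rw [← mul_assoc, h0, one_mul, ← ENNReal.ofReal_mul (Real.exp_pos _).le, ← Real.exp_add] at h3
    refine h3.trans (ENNReal.ofReal_le_ofReal (Real.exp_le_exp.2 (le_of_eq ?_)))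
    rw [← sq_abs s, hs]; ring
  have hsub : {x : EuclideanSpace ℝ (Fin d) | ¬ |‖x‖ - r| ≤ δ * r} ⊆
      {x | δ / 4 * d + |δ / 4| * δ * d ≤ δ / 4 * ‖x‖ ^ 2} ∪
      {x | -(δ / 4) * d + |-(δ / 4)| * δ * d ≤ -(δ / 4) * ‖x‖ ^ 2} := by
    intro x hx
    have hx' : δ * r < |‖x‖ - r| := not_le.1 hx
    have hn : 0 ≤ ‖x‖ := norm_nonneg x
    have habs : |δ / 4| = δ / 4 := abs_of_nonneg (by positivity)
    rcases lt_abs.1 hx' with h | h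
    · left
      have h1 : (1 + δ) * d ≤ ‖x‖ ^ 2 := by
        rw [← hrd]
        have : (1 + δ) * r ≤ ‖x‖ := by linarith
        have h2 := pow_le_pow_left₀ (by positivity) this 2
        nlinarith [mul_nonneg hδ0 (sq_nonneg r), sq_nonneg (δ * r)]
      simp only [Set.mem_ofPred_eq, habs]
      nlinarith
    · right
      have h1 : ‖x‖ ^ 2 ≤ (1 - δ) * d := by
        rw [← hrd]
        have : ‖x‖ ≤ (1 - δ) * r := by linarith
        have h2 := pow_le_pow_left₀ hn this 2
        nlinarith [mul_nonneg (mul_nonneg hδ0 (sub_nonneg.2 (hδ.trans (by norm_num : (1:ℝ)/4 ≤ 1))))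
          (sq_nonneg r)]
      simp only [Set.mem_ofPred_eq, abs_neg, habs]
      nlinarith
  refine (measure_mono hsub).trans ((measure_union_le _ _).trans ?_)
  rw [two_mul, ENNReal.ofReal_add (Real.exp_pos _).le (Real.exp_pos _).le]
  exact add_le_add (key _ (abs_of_nonneg (by positivity)))
    (key _ (by rw [abs_neg]; exact abs_of_nonneg (by positivity)))

section Deviation

variable {V : Type*} [NormedAddCommGroup V] [InnerProductSpace ℝ V] [FiniteDimensional ℝ V]
  [MeasurableSpace V] [BorelSpace V]

/-- Only the earlier vectors are normalised, so these inner products are linear in the Gaussian `y`.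
The covariance perturbation adds at most `‖u‖ ^ 2 / 8` to the exponent; the integral of `exp (‖u‖ ^
2 / 4)` costs at most 2 per coordinate, and the normalising constant at most another 2. -/
theorem lintegral_exp_sum_inner_direction_sq_le {r δ : ℝ} (hr : 0 < r) (hδ0 : 0 ≤ δ)
    (hδ : δ ≤ 1 / 4) {k : ℕ} {x : Fin k → V} (hx : AlmostOrthogonal r δ x) :
    ∫⁻ y, ENNReal.ofReal (Real.exp ((∑ i, inner ℝ (direction (x i)) y ^ 2) / 8)) ∂stdGaussian V ≤
      2 ^ (k + 1) := by
  have h := lintegral_inner_stdGaussian_le (fun i => direction (x i)) (gramOff x)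
    (hx.one_add_gramOff hr hδ) (by simp [trace, gramOff]) hδ0 hδ (hx.sum_gramOff_sq_le hr hδ)
    (fun u => ENNReal.ofReal (Real.exp ((∑ i, u i ^ 2) / 8))) (by fun_prop)
  refine h.trans ?_
  have h2 : ∀ u : Fin k → ℝ, ENNReal.ofReal (Real.exp ((∑ i, u i ^ 2) / 8)) *
      ENNReal.ofReal (Real.exp (u ⬝ᵥ (gramOff x *ᵥ u) / 2)) ≤
      ENNReal.ofReal (Real.exp (1 / 4 * (u ⬝ᵥ u))) := by
    intro u
    rw [← ENNReal.ofReal_mul (Real.exp_pos _).le, ← Real.exp_add]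
    refine ENNReal.ofReal_le_ofReal (Real.exp_le_exp.2 ?_)
    have h3 := (abs_le.1 (abs_dotProduct_mulVec_le (gramOff x) hδ0
      (hx.sum_gramOff_sq_le hr hδ) u)).2
    have h4 : ∑ i, u i ^ 2 = u ⬝ᵥ u := by simp [dotProduct, sq]
    have h5 := dotProduct_self_nonneg u
    rw [h4]
    nlinarith
  have h3 := (lintegral_mono (μ := gaussianPi k) h2).trans
    (le_of_eq (lintegral_exp_mul_dotProduct_self (by norm_num) k))
  refine (mul_le_mul_right h3 _).trans ?_
  rw [pow_succ, mul_comm]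
  have e1 : ENNReal.ofReal (Real.exp (δ ^ 2 / 2)) ≤ 2 := by
    rw [show (2 : ℝ≥0∞) = ENNReal.ofReal 2 by simp]
    refine ENNReal.ofReal_le_ofReal ?_
    have h6 : Real.exp (δ ^ 2 / 2) ≤ Real.exp (1 / 32) := Real.exp_le_exp.2 (by nlinarith)
    have h7 : Real.exp (1 / 32) ≤ Real.exp (Real.log 2) :=
      Real.exp_le_exp.2 (by linarith [Real.log_two_gt_d9])
    rw [Real.exp_log two_pos] at h7
    linarith
  have e2 : ENNReal.ofReal ((Real.sqrt (1 - 2 * (1 / 4)))⁻¹) ≤ 2 := by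
    rw [show (2 : ℝ≥0∞) = ENNReal.ofReal 2 by simp]
    refine ENNReal.ofReal_le_ofReal ?_
    rw [inv_le_comm₀ (Real.sqrt_pos.2 (by norm_num)) two_pos]
    exact Real.le_sqrt_of_sq_le (by norm_num)
  exact mul_le_mul' (pow_le_pow_left' e2 k) e1

/-- Independent Gaussian vectors are almost orthogonal with high probability. -/
theorem pi_stdGaussian_not_almostOrthogonal_le {r δ : ℝ} (hr : 0 < r) (hδ0 : 0 ≤ δ)
    (hδ : δ ≤ 1 / 4) (m : ℕ) :
    (Measure.pi fun _ : Fin m => stdGaussian V) {x | ¬ AlmostOrthogonal r δ x} ≤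
      2 ^ (m * m) * ENNReal.ofReal (Real.exp (-(δ ^ 2 * r ^ 2 / 32))) +
        m * stdGaussian V {x | ¬ |‖x‖ - r| ≤ δ * r} := by
  classical
  set ρ := stdGaussian V {x | ¬ |‖x‖ - r| ≤ δ * r} with hρ
  set h : V → V → ℝ := fun a b => inner ℝ (direction a) b ^ 2 with hh
  set T := δ ^ 2 * r ^ 2 / 4 with hT
  -- `Ψ k` bounds the conditional probability of eventual failure: an exponential Markov term for
  -- the pair sum, plus `ρ` for each norm still to be drawn. Once failure has occurred it is 1.
  set Ψ : ∀ k : ℕ, (Fin k → V) → ℝ≥0∞ := fun k x =>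
    if AlmostOrthogonal r δ x then
      2 ^ (m * (m - k)) * ENNReal.ofReal (Real.exp ((pairSum h x - T) / 8)) + (m - k : ℕ) * ρ
    else 1 with hΨ
  have hΨm : ∀ k, Measurable (Ψ k) := by
    intro k
    have h2 := measurable_pairSum (k := k) (g := h)
      ((measurable_inner_direction (V := V)).pow_const 2)
    exact Measurable.ite (measurableSet_almostOrthogonal r δ k) (by fun_prop) measurable_const
  have hnorm : MeasurableSet {y : V | ¬ |‖y‖ - r| ≤ δ * r} := by
    have : MeasurableSet {y : V | |‖y‖ - r| ≤ δ * r} :=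
      measurableSet_le (by fun_prop) measurable_const
    exact this.compl
  have hstep : ∀ k < m, ∀ x : Fin k → V,
      ∫⁻ y, Ψ (k + 1) (Fin.snoc (α := fun _ => V) x y) ∂stdGaussian V ≤ Ψ k x := by
    intro k hk x
    by_cases hx : AlmostOrthogonal r δ x
    · have hsum0 : ∀ y, 0 ≤ ∑ i, h (x i) y := fun y => sum_nonneg fun i _ => sq_nonneg _
      set A : ℝ≥0∞ := 2 ^ (m * (m - (k + 1))) * ENNReal.ofReal (Real.exp ((pairSum h x - T) / 8))
        with hA
      have hA' : ∀ y, A * ENNReal.ofReal (Real.exp ((∑ i, h (x i) y) / 8)) =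
          2 ^ (m * (m - (k + 1))) * ENNReal.ofReal
            (Real.exp ((pairSum h (Fin.snoc (α := fun _ => V) x y) - T) / 8)) := by
        intro y
        rw [hA, mul_assoc, ← ENNReal.ofReal_mul (Real.exp_pos _).le, ← Real.exp_add, pairSum_snoc]
        congr 3; ring
      have hle : ∀ y, Ψ (k + 1) (Fin.snoc (α := fun _ => V) x y) ≤
          A * ENNReal.ofReal (Real.exp ((∑ i, h (x i) y) / 8)) +
            (({y : V | ¬ |‖y‖ - r| ≤ δ * r}.indicator 1 y) + (m - (k + 1) : ℕ) * ρ) := by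
        intro y
        simp only [hΨ]
        split_ifs with hy
        · rw [hA']
          exact add_le_add_right le_add_self _
        · by_cases hyn : |‖y‖ - r| ≤ δ * r
          -- If the new norm is acceptable, failure must come from the pair sum crossing `T`, and
          -- then the exponential term alone is at least 1.
          · have hlt : T < pairSum h (Fin.snoc (α := fun _ => V) x y) := by
              by_contra hcon
              refine hy ⟨fun j => ?_, not_lt.1 hcon⟩
              refine Fin.lastCases ?_ (fun i => ?_) j
              · simpa using hyn
              · simpa using hx.1 i
            refine le_trans ?_ le_self_add
            rw [hA']
            refine one_le_mul (one_le_pow₀ one_le_two) ?_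
            rw [ENNReal.one_le_ofReal]
            exact Real.one_le_exp (by linarith)
          · refine le_trans ?_ le_add_self
            refine le_trans ?_ le_self_add
            rw [Set.indicator_of_mem (show y ∈ {y : V | ¬ |‖y‖ - r| ≤ δ * r} from hyn)]
            simp
      refine (lintegral_mono hle).trans ?_
      have hmeas : Measurable fun y => ENNReal.ofReal (Real.exp ((∑ i, h (x i) y) / 8)) := by
        simp only [hh]; fun_prop
      rw [lintegral_add_left (hmeas.const_mul A), lintegral_const_mul _ hmeas,
        lintegral_add_left (measurable_one.indicator hnorm), lintegral_indicator_one hnorm,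
        lintegral_const, measure_univ, mul_one]
      simp only [hΨ, if_pos hx]
      refine add_le_add ?_ (le_of_eq ?_)
      · refine (mul_le_mul_right (lintegral_exp_sum_inner_direction_sq_le hr hδ0 hδ hx) A).trans ?_
        rw [hA, mul_right_comm, ← pow_add]
        gcongr
        · exact one_le_two
        · have : m - k = (m - (k + 1)) + 1 := by omega
          rw [this, mul_add, mul_one]
          omega
      · have : m - k = (m - (k + 1)) + 1 := by omega
        rw [this]
        push_cast
        ring
    · have hone : ∀ y, Ψ (k + 1) (Fin.snoc (α := fun _ => V) x y) = 1 := fun y =>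
        if_neg fun h' => hx (AlmostOrthogonal.of_snoc h').1
      simp only [hone, lintegral_const, measure_univ, mul_one]
      exact le_of_eq (if_neg hx).symm
  have hfin := lintegral_pi_le_of_step (stdGaussian V) Ψ hΨm m hstep
  have hbad : MeasurableSet {x : Fin m → V | ¬ AlmostOrthogonal r δ x} :=
    (measurableSet_almostOrthogonal r δ m).compl
  have h0 : AlmostOrthogonal r δ (Fin.elim0 : Fin 0 → V) :=
    ⟨fun j => j.elim0, by simp only [pairSum, univ_eq_empty, sum_empty]; positivity⟩
  calc (Measure.pi fun _ : Fin m => stdGaussian V) {x | ¬ AlmostOrthogonal r δ x}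
      = ∫⁻ x, {x : Fin m → V | ¬ AlmostOrthogonal r δ x}.indicator 1 x
          ∂(Measure.pi fun _ => stdGaussian V) := (lintegral_indicator_one hbad).symm
    _ ≤ ∫⁻ x, Ψ m x ∂(Measure.pi fun _ => stdGaussian V) := by
        refine lintegral_mono fun x => ?_
        by_cases hx : AlmostOrthogonal r δ x
        · rw [Set.indicator_of_notMem (show x ∉ {x : Fin m → V | ¬ AlmostOrthogonal r δ x} from
            fun h' => h' hx)]
          exact zero_le
        · simp only [hΨ, if_neg hx]
          exact Set.indicator_le_self _ _ _
    _ ≤ _ := by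
        refine hfin.trans ?_
        simp only [hΨ, if_pos h0]
        refine le_of_eq ?_
        have : pairSum h (Fin.elim0 : Fin 0 → V) = 0 := by simp [pairSum]
        rw [this]
        simp only [Nat.sub_zero]
        congr 4
        rw [hT]; ring

end Deviation

/-- The expected weight of a clique on `m` independent Gaussian vectors. -/
theorem lintegral_pairProd_signWeight_le {d : ℕ} (hd : 0 < d) {p c : ℝ} (hp : 0 ≤ p)
    (hc : |c| ≤ 1 / 2) (hpc : p * (1 + |c|) ≤ 1) {δ : ℝ} (hδ0 : 0 ≤ δ) (hδ : δ ≤ 1 / 128) (m : ℕ)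
    (hm : (m : ℝ) ≤ δ * Real.sqrt d) :
    ∫⁻ x, ENNReal.ofReal (pairProd (fun a b => p * signWeight c a b) x)
        ∂(Measure.pi fun _ : Fin m => stdGaussian (EuclideanSpace ℝ (Fin d))) ≤
      ENNReal.ofReal (p ^ (m.choose 2) * Real.exp ((c * gaussianAbsMean) ^ 3 *
          (m * (m - 1) * (m - 2) / 6) / Real.sqrt d + 600 * δ ^ 2 * m ^ 2) +
        (2 ^ (m * m) + 2 * m) * Real.exp (-(δ ^ 2 * d / 32))) := by
  set E := EuclideanSpace ℝ (Fin d)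
  set r := Real.sqrt d with hr
  have hr0 : 0 < r := Real.sqrt_pos.2 (Nat.cast_pos.2 hd)
  have hrd : r ^ 2 = d := Real.sq_sqrt (Nat.cast_nonneg d)
  have hw0 : ∀ a b : E, 0 ≤ p * signWeight c a b := fun a b =>
    mul_nonneg hp (one_add_mul_sign_mem hc _).1
  have hw1 : ∀ a b : E, p * signWeight c a b ≤ 1 := by
    intro a b
    refine le_trans (mul_le_mul_of_nonneg_left ?_ hp) hpc
    have h1 := le_abs_self (c * Real.sign (inner ℝ a b))
    rw [abs_mul] at h1
    have := mul_le_mul_of_nonneg_left (abs_real_sign_le (inner ℝ a b)) (abs_nonneg c)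
    rw [signWeight]
    linarith
  have hmeas := measurableSet_almostOrthogonal (V := E) r δ m
  rw [← lintegral_add_compl _ hmeas, ENNReal.ofReal_add (by positivity) (by positivity)]
  refine add_le_add ?_ ?_
  · have h1 := lintegral_clique_almostOrthogonal_le (V := E) hc hr0 hδ0 hδ m hm
    simp_rw [pairProd_const_mul]
    simp_rw [ENNReal.ofReal_mul (pow_nonneg hp _)]
    rw [lintegral_const_mul' _ _ ENNReal.ofReal_ne_top]
    exact mul_le_mul_right h1 _
  -- Off the almost orthogonal event the weight, a product of probabilities, is bounded by 1.
  · refine le_trans (lintegral_mono (g := fun _ => 1) fun x => ?_) ?_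
    · rw [← ENNReal.ofReal_one]
      exact ENNReal.ofReal_le_ofReal (pairProd_le_one hw0 hw1 x)
    rw [lintegral_const, one_mul, Measure.restrict_apply_univ]
    refine (pi_stdGaussian_not_almostOrthogonal_le (V := E) hr0 hδ0 (by linarith) m).trans ?_
    refine (add_le_add_right (mul_le_mul_right
      (stdGaussian_norm_deviation_le d hδ0 (by linarith)) _) _).trans ?_
    rw [hrd, add_mul, ENNReal.ofReal_add (by positivity) (by positivity),
      ENNReal.ofReal_mul (by positivity : (0 : ℝ) ≤ 2 ^ (m * m)),
      ENNReal.ofReal_pow zero_le_two, ENNReal.ofReal_ofNat,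
      ← ENNReal.ofReal_natCast m, ← ENNReal.ofReal_mul (Nat.cast_nonneg m)]
    refine add_le_add_right (ENNReal.ofReal_le_ofReal ?_) _
    have : Real.exp (-(δ ^ 2 * d / 8)) ≤ Real.exp (-(δ ^ 2 * d / 32)) :=
      Real.exp_le_exp.2 (by nlinarith [mul_nonneg (sq_nonneg δ) (Nat.cast_nonneg (α := ℝ) d)])
    nlinarith [Nat.cast_nonneg (α := ℝ) m]

/-! ### The first moment method for random graphs on random points. -/

section RandomGraph

variable {V : Type*}

theorem exists_embedding_of_isNClique {G : SimpleGraph V} {m : ℕ} {s : Finset V}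
    (hs : G.IsNClique m s) : ∃ e : Fin m ↪ V, ∀ i j, i < j → G.Adj (e i) (e j) := by
  have hcard : Fintype.card s = m := by simpa using hs.card_eq
  let f : Fin m ≃ s := (Fintype.equivFinOfCardEq hcard).symm
  refine ⟨f.toEmbedding.trans (Function.Embedding.subtype _), fun i j hij => ?_⟩
  refine hs.isClique (f i).2 (f j).2 fun h => hij.ne ?_
  exact f.injective (Subtype.ext h)

variable [DecidableEq V]

theorem sum_prod_bool_eq_one {ι : Type*} [Fintype ι] [DecidableEq ι] (w : ι → ℝ) :
    ∑ σ : ι → Bool, ∏ e, (if σ e then w e else 1 - w e) = 1 := by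
  have := Finset.prod_univ_sum (fun _ : ι => (univ : Finset Bool))
    (fun e b => if b = true then w e else 1 - w e)
  rw [Fintype.piFinset_univ] at this
  rw [← this]
  simp

/-- Independence of the edges: the sum of products factorises, and each coordinate outside `S`
contributes `w + (1 - w) = 1`. -/
theorem sum_prod_bool_forall {ι : Type*} [Fintype ι] [DecidableEq ι] (w : ι → ℝ) (S : Finset ι)
    (b₀ : Bool) :
    ∑ σ : ι → Bool, (if ∀ e ∈ S, σ e = b₀ then ∏ e, (if σ e then w e else 1 - w e) else 0) =
      ∏ e ∈ S, (if b₀ then w e else 1 - w e) := by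
  have h := Finset.prod_univ_sum (fun _ : ι => (univ : Finset Bool))
    (fun e b => if e ∈ S → b = b₀ then (if b = true then w e else 1 - w e) else 0)
  rw [Fintype.piFinset_univ] at h
  have h2 : ∀ σ : ι → Bool,
      (if ∀ e ∈ S, σ e = b₀ then ∏ e, (if σ e then w e else 1 - w e) else 0) =
      ∏ e, (if e ∈ S → σ e = b₀ then (if σ e = true then w e else 1 - w e) else 0) := by
    intro σ
    split_ifs with hσ
    · exact prod_congr rfl fun e _ => by rw [if_pos (hσ e)]
    · push Not at hσ
      obtain ⟨e, he, hne⟩ := hσ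
      exact (prod_eq_zero (mem_univ e) (if_neg fun h' => hne (h' he))).symm
  simp_rw [h2]
  rw [← h, ← prod_subset (subset_univ S)]
  · refine prod_congr rfl fun e he => ?_
    cases b₀ <;> simp [he]
  · intro e _ he
    simp [he]

/-- The pairs of vertices in the image of an embedding. -/
def edgeImage {m : ℕ} (e : Fin m ↪ V) : Finset (Sym2 V) :=
  (univ.filter fun q : Fin m × Fin m => q.1 < q.2).image fun q => s(e q.1, e q.2)

theorem prod_edgeImage {m : ℕ} (e : Fin m ↪ V) (w : Sym2 V → ℝ) (g : V → V → ℝ)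
    (hg : ∀ u v, w s(u, v) = g u v) : ∏ q ∈ edgeImage e, w q = pairProd g e := by
  rw [edgeImage, prod_image]
  · simp only [hg]
    rw [prod_filter, ← univ_product_univ, prod_product_right]
    rfl
  · rintro ⟨i, j⟩ hij ⟨i', j'⟩ hij' h
    have h1 : i < j := by simpa using hij
    have h2 : i' < j' := by simpa using hij'
    simp only [Sym2.eq_iff, e.injective.eq_iff] at h
    rcases h with ⟨rfl, rfl⟩ | ⟨rfl, rfl⟩
    · rfl
    · exact absurd h1 h2.not_gt

variable [Fintype V]

/-- The first moment method for a random graph with prescribed edge probabilities. -/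
theorem exists_graph_of_sum_pairProd_lt_one (g : V → V → ℝ) (hsymm : ∀ u v, g u v = g v u)
    (h0 : ∀ u v, 0 ≤ g u v) (h1 : ∀ u v, g u v ≤ 1) (a b : ℕ)
    (h : ∑ e : Fin a ↪ V, pairProd g e + ∑ e : Fin b ↪ V, pairProd (fun u v => 1 - g u v) e < 1) :
    ∃ G : SimpleGraph V, (¬ ∃ s, G.IsNClique a s) ∧ ¬ ∃ s, Gᶜ.IsNClique b s := by
  classical
  set w : Sym2 V → ℝ := Sym2.lift ⟨g, hsymm⟩ with hw
  have hwg : ∀ u v, w s(u, v) = g u v := fun u v => rfl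
  have hw01 : ∀ e, 0 ≤ w e ∧ w e ≤ 1 := by
    intro e
    induction e with
    | _ u v => exact ⟨h0 u v, h1 u v⟩
  set W : (Sym2 V → Bool) → ℝ := fun σ => ∏ e, (if σ e then w e else 1 - w e) with hW
  have hW0 : ∀ σ, 0 ≤ W σ := fun σ => prod_nonneg fun e _ => by
    split_ifs
    · exact (hw01 e).1
    · exact sub_nonneg.2 (hw01 e).2
  have hred : ∀ e : Fin a ↪ V, pairProd g e =
      ∑ σ, if ∀ q ∈ edgeImage e, σ q = true then W σ else 0 := by
    intro e
    rw [sum_prod_bool_forall, ← prod_edgeImage e w g hwg]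
    simp
  have hblue : ∀ e : Fin b ↪ V, pairProd (fun u v => 1 - g u v) e =
      ∑ σ, if ∀ q ∈ edgeImage e, σ q = false then W σ else 0 := by
    intro e
    rw [sum_prod_bool_forall, ← prod_edgeImage e (fun q => 1 - w q) _ fun u v => by rw [hwg]]
    simp
  -- If every colouring had a forbidden clique, each weight `W σ` would be counted at least once, so
  -- the first moment would be at least the total weight 1.
  by_contra hcon
  push Not at hcon
  refine absurd h (not_lt.2 ?_)
  simp_rw [hred, hblue]
  rw [sum_comm, sum_comm (s := (univ : Finset (Fin b ↪ V))), ← sum_add_distrib,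
    ← sum_prod_bool_eq_one w]
  refine sum_le_sum fun σ _ => ?_
  set G : SimpleGraph V := SimpleGraph.fromRel fun u v => σ s(u, v) = true with hG
  have hadj : ∀ u v, G.Adj u v ↔ u ≠ v ∧ σ s(u, v) = true := by
    intro u v
    simp [hG, SimpleGraph.fromRel_adj, Sym2.eq_swap (a := v)]
  have nn1 : ∀ e : Fin a ↪ V, 0 ≤ if ∀ q ∈ edgeImage e, σ q = true then W σ else 0 := by
    intro e; split_ifs <;> simp [hW0]
  have nn2 : ∀ e : Fin b ↪ V, 0 ≤ if ∀ q ∈ edgeImage e, σ q = false then W σ else 0 := by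
    intro e; split_ifs <;> simp [hW0]
  by_cases hc : ∃ s, G.IsNClique a s
  · obtain ⟨s, hs⟩ := hc
    obtain ⟨e, he⟩ := exists_embedding_of_isNClique hs
    refine le_trans ?_ (le_add_of_nonneg_right (sum_nonneg fun e _ => nn2 e))
    refine le_trans ?_ (single_le_sum (fun e _ => nn1 e) (mem_univ e))
    rw [if_pos]
    intro q hq
    simp only [edgeImage, mem_image, mem_filter, mem_univ, true_and] at hq
    obtain ⟨⟨i, j⟩, hij, rfl⟩ := hq
    exact ((hadj _ _).1 (he i j hij)).2
  · obtain ⟨s, hs⟩ := hcon G fun s hs => hc ⟨s, hs⟩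
    obtain ⟨e, he⟩ := exists_embedding_of_isNClique hs
    refine le_trans ?_ (le_add_of_nonneg_left (sum_nonneg fun e _ => nn1 e))
    refine le_trans ?_ (single_le_sum (fun e _ => nn2 e) (mem_univ e))
    rw [if_pos]
    intro q hq
    simp only [edgeImage, mem_image, mem_filter, mem_univ, true_and] at hq
    obtain ⟨⟨i, j⟩, hij, rfl⟩ := hq
    have h3 := he i j hij
    rw [SimpleGraph.compl_adj, hadj] at h3
    by_contra hne
    exact h3.2 ⟨h3.1, by simpa using hne⟩

theorem card_embedding_le (m n : ℕ) : Fintype.card (Fin m ↪ Fin n) ≤ n ^ m := by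
  rw [Fintype.card_embedding_eq]
  simpa using Nat.descFactorial_le_pow n m

end RandomGraph

/-- A subfamily of independent points is again independent with the same law, so every potential
clique has the same expected weight. -/
theorem map_pi_comp_embedding {α : Type*} [MeasurableSpace α] (ν : Measure α)
    [IsProbabilityMeasure ν] {m n : ℕ} (e : Fin m ↪ Fin n) :
    (Measure.pi fun _ : Fin n => ν).map (fun x i => x (e i)) = Measure.pi fun _ : Fin m => ν := by
  have h1 := iIndepFun_pi (μ := fun _ : Fin n => ν) (X := fun _ a => a) fun i => aemeasurable_id
  have h2 := h1.precomp e.injective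
  rw [iIndepFun_iff_map_fun_eq_pi_map (fun i => (measurable_pi_apply _).aemeasurable)] at h2
  refine h2.trans ?_
  congr 1
  funext i
  exact (measurePreserving_eval (fun _ : Fin n => ν) (e i)).map_eq

/-- A lower bound criterion for Ramsey numbers by the first moment method, for random graphs whose
edges depend on independent random points. -/
theorem not_isRamsey_of_lintegral {α : Type*} [MeasurableSpace α] (ν : Measure α)
    [IsProbabilityMeasure ν] (g : α → α → ℝ) (hg : Measurable (Function.uncurry g))
    (hsymm : ∀ u v, g u v = g v u) (h0 : ∀ u v, 0 ≤ g u v) (h1 : ∀ u v, g u v ≤ 1) (n a b : ℕ)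
    (A B : ℝ) (hA0 : 0 ≤ A) (hB0 : 0 ≤ B)
    (hA : ∫⁻ x, ENNReal.ofReal (pairProd g x) ∂(Measure.pi fun _ : Fin a => ν) ≤ ENNReal.ofReal A)
    (hB : ∫⁻ x, ENNReal.ofReal (pairProd (fun u v => 1 - g u v) x)
      ∂(Measure.pi fun _ : Fin b => ν) ≤ ENNReal.ofReal B)
    (h : n ^ a * A + n ^ b * B < 1) : ¬ IsRamsey n a b := by
  have hg' : Measurable (Function.uncurry fun u v => 1 - g u v) := hg.const_sub 1
  have h0' : ∀ u v, 0 ≤ 1 - g u v := fun u v => sub_nonneg.2 (h1 u v)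
  have key : ∀ (m : ℕ) (f : α → α → ℝ) (_ : Measurable (Function.uncurry f))
      (_ : ∀ u v, 0 ≤ f u v) (C : ℝ) (_ : 0 ≤ C)
      (_ : ∫⁻ x, ENNReal.ofReal (pairProd f x) ∂(Measure.pi fun _ : Fin m => ν) ≤
        ENNReal.ofReal C),
      ∫⁻ x, ENNReal.ofReal (∑ e : Fin m ↪ Fin n, pairProd (fun u v => f (x u) (x v)) e)
        ∂(Measure.pi fun _ : Fin n => ν) ≤ ENNReal.ofReal (n ^ m * C) := by
    intro m f hf hf0 C hC0 hC
    have e1 : ∀ x : Fin n → α,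
        ENNReal.ofReal (∑ e : Fin m ↪ Fin n, pairProd (fun u v => f (x u) (x v)) e) =
        ∑ e : Fin m ↪ Fin n, ENNReal.ofReal (pairProd f fun i => x (e i)) :=
      fun x => ENNReal.ofReal_sum_of_nonneg fun e _ => pairProd_nonneg (fun u v => hf0 _ _) e
    have hm : Measurable fun x : Fin m → α => ENNReal.ofReal (pairProd f x) :=
      (measurable_pairProd hf).ennreal_ofReal
    simp_rw [e1]
    rw [lintegral_finsetSum _ fun e _ => hm.comp (f := fun (x : Fin n → α) i => x (e i))
      (by fun_prop)]
    have e2 : ∀ e : Fin m ↪ Fin n, ∫⁻ x, ENNReal.ofReal (pairProd f fun i => x (e i))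
        ∂(Measure.pi fun _ : Fin n => ν) ≤ ENNReal.ofReal C := by
      intro e
      refine le_trans (le_of_eq ?_) hC
      rw [← map_pi_comp_embedding ν e, lintegral_map hm (by fun_prop)]
    refine (sum_le_sum fun e _ => e2 e).trans ?_
    rw [sum_const, nsmul_eq_mul, ENNReal.ofReal_mul (by positivity)]
    refine mul_le_mul_left ?_ _
    rw [← ENNReal.ofReal_natCast]
    refine ENNReal.ofReal_le_ofReal ?_
    rw [card_univ]
    exact_mod_cast card_embedding_le m n
  have hAB : ∫⁻ x, ENNReal.ofReal (∑ e : Fin a ↪ Fin n, pairProd (fun u v => g (x u) (x v)) e +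
        ∑ e : Fin b ↪ Fin n, pairProd (fun u v => 1 - g (x u) (x v)) e)
        ∂(Measure.pi fun _ : Fin n => ν) < 1 := by
    have e1 : ∀ x : Fin n → α, ENNReal.ofReal
        (∑ e : Fin a ↪ Fin n, pairProd (fun u v => g (x u) (x v)) e +
          ∑ e : Fin b ↪ Fin n, pairProd (fun u v => 1 - g (x u) (x v)) e) =
        ENNReal.ofReal (∑ e : Fin a ↪ Fin n, pairProd (fun u v => g (x u) (x v)) e) +
        ENNReal.ofReal (∑ e : Fin b ↪ Fin n, pairProd (fun u v => 1 - g (x u) (x v)) e) :=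
      fun x => ENNReal.ofReal_add (sum_nonneg fun e _ => pairProd_nonneg (fun u v => h0 _ _) e)
        (sum_nonneg fun e _ => pairProd_nonneg (fun u v => h0' _ _) e)
    have hmA : Measurable fun x : Fin n → α =>
        ENNReal.ofReal (∑ e : Fin a ↪ Fin n, pairProd (fun u v => g (x u) (x v)) e) := by
      refine (Finset.measurable_fun_sum _ fun e _ => ?_).ennreal_ofReal
      exact (measurable_pairProd hg).comp (f := fun (x : Fin n → α) i => x (e i)) (by fun_prop)
    simp_rw [e1]
    rw [lintegral_add_left hmA]
    refine (add_le_add (key a g hg h0 A hA0 hA) (key b _ hg' h0' B hB0 hB)).trans_lt ?_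
    rw [← ENNReal.ofReal_add (by positivity) (by positivity), ENNReal.ofReal_lt_one]
    exact h
  -- An average below 1 yields one configuration of points with conditional first moment below 1;
  -- the edges are then chosen for these fixed points.
  obtain ⟨x, hx⟩ : ∃ x : Fin n → α, ENNReal.ofReal
      (∑ e : Fin a ↪ Fin n, pairProd (fun u v => g (x u) (x v)) e +
        ∑ e : Fin b ↪ Fin n, pairProd (fun u v => 1 - g (x u) (x v)) e) < 1 := by
    by_contra hcon
    push Not at hcon
    have := lintegral_mono (μ := Measure.pi fun _ : Fin n => ν) hcon
    rw [lintegral_const, measure_univ, mul_one] at this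
    exact absurd hAB (not_lt.2 this)
  rw [ENNReal.ofReal_lt_one] at hx
  obtain ⟨G, hG1, hG2⟩ := exists_graph_of_sum_pairProd_lt_one (fun u v => g (x u) (x v))
    (fun u v => hsymm _ _) (fun u v => h0 _ _) (fun u v => h1 _ _) a b hx
  exact fun hR => (hR G).elim hG1 hG2

/-- A quantitative lower bound criterion for Ramsey numbers from Gaussian random graphs. -/
theorem not_isRamsey_of_gaussian {n a m d : ℕ} (hd : 0 < d) {p b δ : ℝ} (hp : 0 < p)
    (hp2 : p ≤ 1 / 2) (hb0 : 0 ≤ b) (hb : b ≤ p / 2) (hδ0 : 0 ≤ δ) (hδ : δ ≤ 1 / 128)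
    (ha : (a : ℝ) ≤ δ * Real.sqrt d) (hm : (m : ℝ) ≤ δ * Real.sqrt d)
    (h : n ^ a * (p ^ (a.choose 2) * Real.exp ((-(b * gaussianAbsMean / p)) ^ 3 *
          (a * (a - 1) * (a - 2) / 6) / Real.sqrt d + 600 * δ ^ 2 * a ^ 2) +
        (2 ^ (a * a) + 2 * a) * Real.exp (-(δ ^ 2 * d / 32))) +
      n ^ m * ((1 - p) ^ (m.choose 2) * Real.exp ((b * gaussianAbsMean / (1 - p)) ^ 3 *
          (m * (m - 1) * (m - 2) / 6) / Real.sqrt d + 600 * δ ^ 2 * m ^ 2) +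
        (2 ^ (m * m) + 2 * m) * Real.exp (-(δ ^ 2 * d / 32))) < 1) :
    ¬ IsRamsey n a m := by
  have hq : 0 < 1 - p := by linarith
  have hr : |(-(b / p))| ≤ 1 / 2 := by
    rw [abs_neg, abs_of_nonneg (by positivity), div_le_iff₀ hp]; linarith
  have hs : |b / (1 - p)| ≤ 1 / 2 := by
    rw [abs_of_nonneg (by positivity), div_le_iff₀ hq]; linarith
  have hR := lintegral_pairProd_signWeight_le hd hp.le hr (by
    rw [abs_neg, abs_of_nonneg (by positivity), mul_add, mul_div_cancel₀ _ hp.ne']; linarith)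
    hδ0 hδ a ha
  have hB := lintegral_pairProd_signWeight_le hd hq.le hs (by
    rw [abs_of_nonneg (by positivity), mul_add, mul_div_cancel₀ _ hq.ne']; linarith) hδ0 hδ m hm
  rw [show -(b / p) * gaussianAbsMean = -(b * gaussianAbsMean / p) by ring] at hR
  rw [show b / (1 - p) * gaussianAbsMean = b * gaussianAbsMean / (1 - p) by ring] at hB
  -- Blue probabilities have the same form with the opposite sign of tilt, so a single clique
  -- estimate serves both colours.
  have hcompl : (fun u v : EuclideanSpace ℝ (Fin d) => 1 - p * signWeight (-(b / p)) u v) =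
      fun u v => (1 - p) * signWeight (b / (1 - p)) u v := by
    funext u v
    simp only [signWeight]
    field_simp
    ring
  refine not_isRamsey_of_lintegral (stdGaussian (EuclideanSpace ℝ (Fin d)))
    (fun u v => p * signWeight (-(b / p)) u v) ((measurable_signWeight _).const_mul p)
    (fun u v => by rw [signWeight_symm]) (fun u v => mul_nonneg hp.le (one_add_mul_sign_mem hr _).1)
    (fun u v => ?_) n a m _ _ ?_ ?_ hR (by rw [hcompl]; exact hB) h
  · have h1 : 0 ≤ (1 - p) * signWeight (b / (1 - p)) u v :=
      mul_nonneg hq.le (one_add_mul_sign_mem hs _).1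
    have h2 := congrFun (congrFun hcompl u) v
    linarith
  · positivity
  · positivity

/-! ### From the finite criterion to exponential rates. -/

theorem pow_choose_two_eq_exp {x : ℝ} (hx : 0 < x) (k : ℕ) :
    x ^ (k.choose 2) = Real.exp (k * (k - 1) / 2 * Real.log x) := by
  rw [← Nat.cast_choose_two, mul_comm, Real.exp_mul, Real.exp_log hx, Real.rpow_natCast]

theorem two_pow_add_le (k : ℕ) : (2 : ℝ) ^ (k * k) + 2 * k ≤ Real.exp (k ^ 2 + 2) := by
  have h1 : (k : ℝ) ≤ 2 ^ (k * k) := by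
    have : k < 2 ^ (k * k) := (Nat.lt_two_pow_self).trans_le
      (Nat.pow_le_pow_right two_pos (Nat.le_mul_self k))
    exact_mod_cast this.le
  have h2 : (2 : ℝ) ^ (k * k) ≤ Real.exp (k ^ 2) := by
    have h3 : (2 : ℝ) ≤ Real.exp 1 := by linarith [Real.exp_one_gt_d9]
    calc (2 : ℝ) ^ (k * k) ≤ Real.exp 1 ^ (k * k) := pow_le_pow_left₀ zero_le_two h3 _
      _ = _ := by rw [← Real.exp_nat_mul]; push_cast; ring_nf
  have h4 : (3 : ℝ) ≤ Real.exp 2 := by linarith [Real.add_one_le_exp 2]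
  rw [Real.exp_add]
  nlinarith [Real.exp_pos ((k : ℝ) ^ 2)]

theorem exp_lt_quarter {x : ℝ} (hx : x ≤ -2) : Real.exp x < 1 / 4 := by
  have h1 : Real.exp x ≤ Real.exp (-2) := Real.exp_le_exp.2 hx
  have h2 : Real.exp (-2) = (Real.exp 1 ^ 2)⁻¹ := by
    rw [← Real.exp_nat_mul, ← Real.exp_neg]; norm_num
  have h3 : (2.7 : ℝ) ≤ Real.exp 1 := by linarith [Real.exp_one_gt_d9]
  have h4 : (Real.exp 1 ^ 2)⁻¹ < 1 / 4 := by
    rw [inv_lt_comm₀ (by positivity) (by norm_num)]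
    nlinarith
  linarith

set_option maxHeartbeats 1000000 in
/-- Asymptotic form of the criterion: if the two exponential rates are negative then the Ramsey
number grows at least like `exp (ω ℓ)`. -/
theorem exp_le_ramseyNumber_of_rates {C : ℝ} (hC : 1 < C) {D : ℕ} (hD : 0 < D) {p b κ L ω : ℝ}
    (hp : 0 < p) (hp2 : p ≤ 1 / 2) (hb0 : 0 ≤ b) (hb : b ≤ p / 2) (hκ : κ = 1 / Real.sqrt D)
    (hω : 0 ≤ ω) (hL : C * ω + C ^ 2 + 1 ≤ L ^ 2 / 32) (hLC : C ≤ L) (hLκ : L * κ ≤ 1 / 128)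
    (hR : ω + Real.log p / 2 - (b * gaussianAbsMean / p) ^ 3 * κ / 6 + 600 * L ^ 2 * κ ^ 2 < 0)
    (hB : ω + C / 2 * Real.log (1 - p) + (b * gaussianAbsMean / (1 - p)) ^ 3 * κ * C ^ 2 / 6 +
      600 * L ^ 2 * κ ^ 2 * C < 0) :
    ∃ ℓ₀ : ℕ, 0 < ℓ₀ ∧ ∀ ℓ : ℕ, ℓ₀ ≤ ℓ →
      Real.exp (ω * ℓ) ≤ (ramseyNumber ℓ ⌊C * (ℓ : ℝ)⌋₊ : ℝ) := by
  have hDs : 0 < Real.sqrt D := Real.sqrt_pos.2 (Nat.cast_pos.2 hD)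
  have hκ0 : 0 < κ := by rw [hκ]; positivity
  have hL0 : 0 < L := by linarith
  have hq : 0 < 1 - p := by linarith
  have hlp : Real.log p ≤ 0 := Real.log_nonpos hp.le (by linarith)
  have hlq : Real.log (1 - p) ≤ 0 := Real.log_nonpos hq.le (by linarith)
  have hm0 := gaussianAbsMean_pos
  set x := b * gaussianAbsMean / p with hx
  set y := b * gaussianAbsMean / (1 - p) with hy
  have hx0 : 0 ≤ x := by positivity
  have hy0 : 0 ≤ y := by positivity
  set R := ω + Real.log p / 2 - x ^ 3 * κ / 6 + 600 * L ^ 2 * κ ^ 2 with hRdef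
  set B := ω + C / 2 * Real.log (1 - p) + y ^ 3 * κ * C ^ 2 / 6 + 600 * L ^ 2 * κ ^ 2 * C with hBdef
  -- `K` collects the terms linear in `ℓ` lost when `ℓ (ℓ - 1)` and `(ℓ - 1) (ℓ - 2)` are replaced
  -- by `ℓ ^ 2`.
  set K := -Real.log p / 2 + x ^ 3 * κ / 2 with hK
  obtain ⟨ℓ₀, hℓ₀⟩ := exists_nat_ge (max ((K + 2) / (-R)) ((-Real.log (1 - p) + 2) / (-B)) + 2)
  refine ⟨ℓ₀ + 1, Nat.succ_pos _, fun ℓ hℓ => ?_⟩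
  have hℓr : max ((K + 2) / (-R)) ((-Real.log (1 - p) + 2) / (-B)) + 2 ≤ ℓ :=
    hℓ₀.trans (by exact_mod_cast (Nat.le_succ _).trans hℓ)
  have hmax1 := le_max_left ((K + 2) / (-R)) ((-Real.log (1 - p) + 2) / (-B))
  have hmax2 := le_max_right ((K + 2) / (-R)) ((-Real.log (1 - p) + 2) / (-B))
  have hK0 : 0 ≤ K := by
    rw [hK]
    have : 0 ≤ x ^ 3 * κ / 2 := by positivity
    linarith
  have hmax0 : 0 ≤ (K + 2) / (-R) := div_nonneg (by linarith) (by linarith)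
  have hℓ2 : (2 : ℝ) ≤ ℓ := by linarith
  have hℓR : ℓ * R + K ≤ -2 := by
    have h1 : (K + 2) / (-R) ≤ ℓ := by linarith
    rw [div_le_iff₀ (by linarith)] at h1
    linarith
  have hℓB : ℓ * B - Real.log (1 - p) ≤ -2 := by
    have h1 : (-Real.log (1 - p) + 2) / (-B) ≤ ℓ := by linarith
    rw [div_le_iff₀ (by linarith)] at h1
    linarith
  by_contra hcon
  rw [not_le] at hcon
  set M := ⌊C * (ℓ : ℝ)⌋₊ with hM
  set n := ramseyNumber ℓ M with hn
  -- The Ramsey number itself serves as the vertex count: if it were below `exp (ω ℓ)`, the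
  -- criterion would show that it lacks the Ramsey property.
  refine absurd (ramseyNumber_spec ℓ M).1.2 ?_
  have hMle : (M : ℝ) ≤ C * ℓ := Nat.floor_le (by positivity)
  have hMgt : C * ℓ < M + 1 := Nat.lt_floor_add_one _
  have hM1 : (1 : ℝ) ≤ M := by
    have : ℓ ≤ M := Nat.le_floor (by nlinarith only [hC, hℓ2])
    have : (ℓ : ℝ) ≤ M := by exact_mod_cast this
    linarith
  have hsqrt : Real.sqrt ((D * ℓ ^ 2 : ℕ) : ℝ) = Real.sqrt D * ℓ := by
    push_cast
    rw [Real.sqrt_mul (Nat.cast_nonneg D), Real.sqrt_sq (Nat.cast_nonneg ℓ)]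
  have hκD : κ * Real.sqrt D = 1 := by rw [hκ]; field_simp
  have hκD2 : κ ^ 2 * D = 1 := by
    rw [← Real.sq_sqrt (Nat.cast_nonneg (α := ℝ) D), ← mul_pow, hκD, one_pow]
  have hδd : L * κ * Real.sqrt ((D * ℓ ^ 2 : ℕ) : ℝ) = L * ℓ := by
    rw [hsqrt]; linear_combination L * ℓ * hκD
  have hδd2 : (L * κ) ^ 2 * ((D * ℓ ^ 2 : ℕ) : ℝ) / 32 = L ^ 2 / 32 * ℓ ^ 2 := by
    push_cast; linear_combination (L ^ 2 * ℓ ^ 2 / 32) * hκD2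
  have hnpow : ∀ k : ℕ, (n : ℝ) ^ k ≤ Real.exp (k * (ω * ℓ)) := by
    intro k
    rw [Real.exp_nat_mul]
    exact pow_le_pow_left₀ (Nat.cast_nonneg n) hcon.le k
  -- The exceptional probability decays like `exp (-L ^ 2 ℓ ^ 2 / 32)`, and `hL` makes this beat
  -- both the number of tuples and the factor `2 ^ (k * k)`.
  have hbad : ∀ k : ℕ, (k : ℝ) ≤ C * ℓ → (n : ℝ) ^ k * ((2 ^ (k * k) + 2 * k) *
      Real.exp (-((L * κ) ^ 2 * ((D * ℓ ^ 2 : ℕ) : ℝ) / 32))) < 1 / 4 := by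
    intro k hk
    rw [hδd2]
    have h1 : (n : ℝ) ^ k * ((2 ^ (k * k) + 2 * k) * Real.exp (-(L ^ 2 / 32 * ℓ ^ 2))) ≤
        Real.exp (k * (ω * ℓ)) * (Real.exp (k ^ 2 + 2) * Real.exp (-(L ^ 2 / 32 * ℓ ^ 2))) :=
      mul_le_mul (hnpow k) (mul_le_mul_of_nonneg_right (two_pow_add_le k) (Real.exp_pos _).le)
        (by positivity) (by positivity)
    refine h1.trans_lt ?_
    rw [← Real.exp_add, ← Real.exp_add]
    apply exp_lt_quarter
    have h2 : k * (ω * ℓ) ≤ C * ℓ * (ω * ℓ) := mul_le_mul_of_nonneg_right hk (by positivity)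
    have h3 : (k : ℝ) ^ 2 ≤ (C * ℓ) ^ 2 := pow_le_pow_left₀ (Nat.cast_nonneg k) hk 2
    have h4 : (C * ω + C ^ 2 + 1) * (ℓ : ℝ) ^ 2 ≤ L ^ 2 / 32 * ℓ ^ 2 :=
      mul_le_mul_of_nonneg_right hL (by positivity)
    have h5 : (4 : ℝ) ≤ ℓ ^ 2 := by nlinarith only [hℓ2]
    linarith only [h2, h3, h4, h5]
  have hred : (n : ℝ) ^ ℓ * (p ^ (ℓ.choose 2) * Real.exp ((-x) ^ 3 *
      (ℓ * (ℓ - 1) * (ℓ - 2) / 6) / Real.sqrt ((D * ℓ ^ 2 : ℕ) : ℝ) +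
        600 * (L * κ) ^ 2 * ℓ ^ 2)) < 1 / 4 := by
    have h1 := mul_le_mul_of_nonneg_right (hnpow ℓ) (show 0 ≤ p ^ (ℓ.choose 2) * Real.exp ((-x) ^ 3 *
      (ℓ * (ℓ - 1) * (ℓ - 2) / 6) / Real.sqrt ((D * ℓ ^ 2 : ℕ) : ℝ) +
        600 * (L * κ) ^ 2 * ℓ ^ 2) by positivity)
    refine h1.trans_lt ?_
    rw [pow_choose_two_eq_exp hp, ← Real.exp_add, ← Real.exp_add]
    apply exp_lt_quarter
    have h2 : (-x) ^ 3 * (ℓ * (ℓ - 1) * (ℓ - 2) / 6) / Real.sqrt ((D * ℓ ^ 2 : ℕ) : ℝ) =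
        -(x ^ 3 * κ * ((ℓ - 1) * (ℓ - 2)) / 6) := by
      rw [hsqrt, hκ]; field_simp
    rw [h2]
    have h3 : 0 ≤ x ^ 3 * κ := by positivity
    have h4 : ℓ * (ω * ℓ) + (ℓ * (ℓ - 1) / 2 * Real.log p + (-(x ^ 3 * κ * ((ℓ - 1) * (ℓ - 2)) / 6) +
        600 * (L * κ) ^ 2 * ℓ ^ 2)) = ℓ * (ℓ * R + K) - x ^ 3 * κ / 3 := by
      rw [hRdef, hK]; ring
    rw [h4]
    nlinarith only [h3, mul_nonneg (sub_nonneg.2 hℓ2) (sub_nonneg.2 hℓR), hℓR, hℓ2]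
  have hblue : (n : ℝ) ^ M * ((1 - p) ^ (M.choose 2) * Real.exp (y ^ 3 *
      (M * (M - 1) * (M - 2) / 6) / Real.sqrt ((D * ℓ ^ 2 : ℕ) : ℝ) +
        600 * (L * κ) ^ 2 * M ^ 2)) < 1 / 4 := by
    have h1 := mul_le_mul_of_nonneg_right (hnpow M) (show 0 ≤ (1 - p) ^ (M.choose 2) *
      Real.exp (y ^ 3 * (M * (M - 1) * (M - 2) / 6) / Real.sqrt ((D * ℓ ^ 2 : ℕ) : ℝ) +
        600 * (L * κ) ^ 2 * M ^ 2) by positivity)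
    refine h1.trans_lt ?_
    rw [pow_choose_two_eq_exp hq, ← Real.exp_add, ← Real.exp_add]
    apply exp_lt_quarter
    have hy3 : 0 ≤ y ^ 3 := by positivity
    have hℓ0 : (0 : ℝ) < ℓ := by linarith
    have h2 : y ^ 3 * (M * (M - 1) * (M - 2) / 6) / Real.sqrt ((D * ℓ ^ 2 : ℕ) : ℝ) ≤
        M * (y ^ 3 * κ * C ^ 2 / 6 * ℓ) := by
      rw [hsqrt, div_le_iff₀ (by positivity)]
      have e1 : M * (y ^ 3 * κ * C ^ 2 / 6 * ℓ) * (Real.sqrt D * ℓ) =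
          y ^ 3 * (M * (C * ℓ) ^ 2 / 6) := by
        linear_combination (M * y ^ 3 * C ^ 2 / 6 * ℓ * ℓ) * hκD
      rw [e1]
      refine mul_le_mul_of_nonneg_left ?_ hy3
      have e2 : ((M : ℝ) - 1) * (M - 2) ≤ (C * ℓ) ^ 2 := by nlinarith only [hMle, hM1]
      nlinarith only [e2, hM1]
    have h3 : (600 : ℝ) * (L * κ) ^ 2 * M ^ 2 ≤ M * (600 * L ^ 2 * κ ^ 2 * C * ℓ) := by
      have : 0 ≤ 600 * (L * κ) ^ 2 * M := by positivity
      linarith only [mul_le_mul_of_nonneg_left hMle this]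
    -- Rounding down gives only `M - 1 ≥ C ℓ - 2`; the loss is the bounded term `-log (1 - p)` in
    -- `hℓB`.
    have h4 : (M : ℝ) * (M - 1) / 2 * Real.log (1 - p) ≤
        M * ((C * ℓ - 2) / 2 * Real.log (1 - p)) := by
      have e1 : (C * ℓ - 2) / 2 ≤ ((M : ℝ) - 1) / 2 := by linarith
      have := mul_le_mul_of_nonneg_left (mul_le_mul_of_nonpos_right e1 hlq) (Nat.cast_nonneg (α := ℝ) M)
      linarith only [this]
    have h5 : M * (ω * ℓ) + (M * ((C * ℓ - 2) / 2 * Real.log (1 - p)) +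
        (M * (y ^ 3 * κ * C ^ 2 / 6 * ℓ) + M * (600 * L ^ 2 * κ ^ 2 * C * ℓ))) =
        M * (ℓ * B - Real.log (1 - p)) := by
      rw [hBdef]; ring
    have h6 : M * (ℓ * B - Real.log (1 - p)) ≤ -2 := by
      nlinarith only [mul_nonneg (sub_nonneg.2 hM1) (sub_nonneg.2 hℓB), hℓB, hM1]
    linarith only [h2, h3, h4, h5, h6]
  -- With these choices `δ √d = L ℓ`, which dominates both clique sizes since `C ≤ L`. Each of the
  -- four resulting terms is below 1/4.
  refine not_isRamsey_of_gaussian (d := D * ℓ ^ 2) (p := p) (b := b) (δ := L * κ) ?_ hp hp2 hb0 hb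
    (by positivity) hLκ ?_ ?_ ?_
  · have : 0 < ℓ := lt_of_lt_of_le (Nat.succ_pos _) hℓ
    positivity
  · rw [hδd]; nlinarith only [hC, hLC, hℓ2]
  · rw [hδd]; nlinarith only [hMle, hLC, hℓ2]
  · rw [mul_add, mul_add]
    have := hbad ℓ (by nlinarith only [hC, hℓ2])
    have := hbad M hMle
    linarith

/-! ### The equation for `p_C` and the inequality behind the gain. -/

/-- The inequality that makes the sparse colour the one to be anticorrelated. -/
theorem sq_mul_log_lt {p : ℝ} (hp : 0 < p) (hp2 : p < 1 / 2) :
    p ^ 2 * (-Real.log p) < (1 - p) ^ 2 * (-Real.log (1 - p)) := by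
  -- At `r = (1 - p) / p`, where `1 + r = 1 / p`, this function times `p ^ 2` is the difference of
  -- the two sides; it vanishes at `r = 1`, that is at `p = 1/2`.
  have hmono : StrictMonoOn (fun r : ℝ => (r ^ 2 - 1) * Real.log (1 + r) - r ^ 2 * Real.log r)
      (Set.Ici 1) := by
    have hderiv : ∀ r : ℝ, 0 < r → HasDerivAt
        (fun r : ℝ => (r ^ 2 - 1) * Real.log (1 + r) - r ^ 2 * Real.log r)
        (2 * r * (Real.log (1 + r) - Real.log r) - 1) r := by
      intro r hr
      have h1 : HasDerivAt (fun r : ℝ => r ^ 2) (2 * r) r := by simpa using hasDerivAt_pow 2 r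
      have h2 : HasDerivAt (fun r : ℝ => Real.log (1 + r)) (1 / (1 + r)) r :=
        ((hasDerivAt_id r).const_add 1).log (by simp; linarith)
      have h3 := ((h1.sub_const 1).mul h2).sub (h1.mul (Real.hasDerivAt_log hr.ne'))
      refine h3.congr_deriv ?_
      have : 1 + r ≠ 0 := by linarith
      field_simp
      ring
    refine strictMonoOn_of_deriv_pos (convex_Ici 1) (fun r hr => ?_) fun r hr => ?_
    · exact (hderiv r (lt_of_lt_of_le one_pos hr)).continuousAt.continuousWithinAt
    · rw [interior_Ici] at hr
      have hr1 : 1 < r := hr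
      rw [(hderiv r (by linarith)).deriv]
      have h4 : 1 / (1 + r) ≤ Real.log (1 + r) - Real.log r := by
        rw [← Real.log_div (by linarith) (by linarith)]
        refine le_trans (le_of_eq ?_) (Real.one_sub_inv_le_log_of_pos (by positivity))
        field_simp
        ring
      have h5 : 1 < 2 * r * (1 / (1 + r)) := by
        rw [mul_one_div, lt_div_iff₀ (by linarith)]; linarith
      nlinarith
  have hr : 1 < (1 - p) / p := by rw [lt_div_iff₀ hp]; linarith
  have h := hmono (Set.mem_Ici.2 le_rfl) (Set.mem_Ici.2 hr.le) hr
  have h1 : 1 + (1 - p) / p = p⁻¹ := by field_simp; ring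
  simp only [h1, Real.log_inv, Real.log_div (show 1 - p ≠ 0 by linarith) hp.ne'] at h
  norm_num at h
  have h2 : ((1 - p) / p) ^ 2 = (1 - p) ^ 2 / p ^ 2 := div_pow _ _ _
  rw [h2] at h
  have h3 : 0 < p ^ 2 := by positivity
  have h4 : (1 - p) ^ 2 / p ^ 2 * (Real.log (1 - p) - Real.log p) <
      -(((1 - p) ^ 2 / p ^ 2 - 1) * Real.log p) := by linarith
  have h5 := mul_lt_mul_of_pos_left h4 h3
  have e1 : p ^ 2 * ((1 - p) ^ 2 / p ^ 2 * (Real.log (1 - p) - Real.log p)) =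
      (1 - p) ^ 2 * (Real.log (1 - p) - Real.log p) := by field_simp
  have e2 : p ^ 2 * -(((1 - p) ^ 2 / p ^ 2 - 1) * Real.log p) =
      -(((1 - p) ^ 2 - p ^ 2) * Real.log p) := by field_simp
  rw [e1, e2] at h5
  linarith

theorem log_div_log_one_sub_strictAnti :
    StrictAntiOn (fun p : ℝ => Real.log p / Real.log (1 - p)) (Set.Ioc 0 (1 / 2)) := by
  intro p hp q hq hpq
  have h1 : Real.log p < Real.log q := Real.log_lt_log hp.1 hpq
  have h2 : Real.log (1 - q) < Real.log (1 - p) :=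
    Real.log_lt_log (by linarith [hq.2]) (by linarith)
  have h3 : Real.log (1 - p) < 0 := Real.log_neg (by linarith [hp.2]) (by linarith [hp.1])
  have h4 : Real.log q < 0 := Real.log_neg hq.1 (by linarith [hq.2])
  simp only
  rw [← neg_div_neg_eq, ← neg_div_neg_eq (Real.log p), div_lt_div_iff₀ (by linarith) (by linarith)]
  nlinarith

theorem existsUnique_log_div_log_eq {C : ℝ} (hC : 1 < C) :
    ∃! p : ℝ, p ∈ Set.Ioo (0 : ℝ) (1 / 2) ∧ C = Real.log p / Real.log (1 - p) := by
  have hcont : ∀ a : ℝ, 0 < a → ContinuousOn (fun p : ℝ => Real.log p / Real.log (1 - p))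
      (Set.Icc a (1 / 2)) := by
    intro a ha
    refine ContinuousOn.div (Real.continuousOn_log.mono fun x hx => ?_)
      (ContinuousOn.log (by fun_prop) fun x hx => ?_) fun x hx => ?_
    · exact (ha.trans_le hx.1).ne'
    · linarith [hx.2]
    · exact (Real.log_neg (by linarith [hx.2]) (by linarith [ha.trans_le hx.1])).ne
  -- At `a` the denominator is at most `2 a ≤ 1 / (2 C)` in absolute value while the numerator
  -- exceeds 1/2, so the quotient is at least `C`.
  set a : ℝ := min (1 / 4) (1 / (4 * C)) with ha
  have ha0 : 0 < a := by positivity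
  have ha4 : a ≤ 1 / 4 := min_le_left _ _
  have haC : a * (4 * C) ≤ 1 := by
    have := min_le_right (1 / 4) (1 / (4 * C))
    rw [← ha, le_div_iff₀ (by positivity)] at this
    exact this
  have hlog1 : -Real.log (1 - a) ≤ 2 * a := by
    have h := Real.one_sub_inv_le_log_of_pos (x := 1 - a) (by linarith)
    have h2 : (1 - a)⁻¹ ≤ 1 + 2 * a := by
      rw [inv_le_iff_one_le_mul₀ (by linarith)]; nlinarith
    linarith
  have hlog2 : (1 / 2 : ℝ) < -Real.log a := by
    have h : Real.log a ≤ Real.log (1 / 2) := Real.log_le_log ha0 (by linarith)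
    rw [one_div, Real.log_inv] at h
    linarith [Real.log_two_gt_d9]
  have hlog3 : Real.log (1 - a) < 0 := Real.log_neg (by linarith) (by linarith)
  have hfa : C ≤ Real.log a / Real.log (1 - a) := by
    rw [← neg_div_neg_eq, le_div_iff₀ (by linarith)]
    nlinarith
  have hfb : Real.log (1 / 2) / Real.log (1 - 1 / 2) = 1 := by
    rw [show (1 : ℝ) - 1 / 2 = 1 / 2 by norm_num]
    exact div_self (Real.log_neg (by norm_num) (by norm_num)).ne
  obtain ⟨p, hp, hpC⟩ := intermediate_value_Icc' (show a ≤ 1 / 2 by linarith) (hcont a ha0)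
    (show C ∈ Set.Icc _ _ from ⟨by simp only [hfb]; exact hC.le, hfa⟩)
  have hp2 : p ≠ 1 / 2 := by
    rintro rfl
    simp only [hfb] at hpC
    linarith
  refine ⟨p, ⟨⟨ha0.trans_le hp.1, lt_of_le_of_ne hp.2 hp2⟩, hpC.symm⟩, ?_⟩
  rintro q ⟨hq, hqC⟩
  refine log_div_log_one_sub_strictAnti.injOn ⟨hq.1, hq.2.le⟩ ⟨ha0.trans_le hp.1, hp.2⟩ ?_
  simp only at hpC ⊢
  rw [← hqC, hpC]

end Auxiliary

/-! ### Choice of parameters and conclusion. -/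

set_option maxHeartbeats 1000000 in
theorem theorem1 (C : ℝ) (hC : 1 < C) :
    (∃! p : ℝ, p ∈ Set.Ioo (0 : ℝ) (1 / 2) ∧ C = Real.log p / Real.log (1 - p)) ∧
    ∀ p : ℝ, p ∈ Set.Ioo (0 : ℝ) (1 / 2) → C = Real.log p / Real.log (1 - p) →
      ∃ ε : ℝ, 0 < ε ∧ ∃ ℓ₀ : ℕ, 0 < ℓ₀ ∧ ∀ ℓ : ℕ, ℓ₀ ≤ ℓ →
        (p ^ (-(1 / 2) : ℝ) + ε) ^ ℓ ≤ (ramseyNumber ℓ ⌊C * (ℓ : ℝ)⌋₊ : ℝ) := by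
  refine ⟨existsUnique_log_div_log_eq hC, fun p hp hpC => ?_⟩
  obtain ⟨hp0, hp2⟩ := hp
  have hq0 : 0 < 1 - p := by linarith
  have hlq : Real.log (1 - p) < 0 := Real.log_neg hq0 (by linarith)
  have hlp : Real.log p = C * Real.log (1 - p) := ((eq_div_iff hlq.ne).1 hpC).symm
  have hlp0 : Real.log p < 0 := Real.log_neg hp0 (by linarith)
  have hm0 := gaussianAbsMean_pos
  -- The tilt is fixed from the unperturbed `p`; it stays admissible after the shift because `p`
  -- only increases.
  set b := p / 2 with hb
  set q := b * gaussianAbsMean with hq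
  have hqpos : 0 < q := by positivity
  have hCp : C * p ^ 2 < (1 - p) ^ 2 := by
    have h := sq_mul_log_lt hp0 hp2
    rw [hlp] at h
    nlinarith
  -- The lower bound makes the shift pay for the blue loss to first order in `κ`; the upper bound
  -- keeps its red cost below the red gain. The interval is nonempty by `hCp`.
  obtain ⟨θ, hθ1, hθ2⟩ : ∃ θ : ℝ, C * q ^ 3 / (3 * (1 - p) ^ 2) < θ ∧ θ < q ^ 3 / (3 * p ^ 2) := by
    refine exists_between ?_
    rw [div_lt_div_iff₀ (by positivity) (by positivity)]
    have : 0 < 3 * q ^ 3 := by positivity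
    nlinarith
  have hθ0 : 0 < θ := lt_trans (by positivity) hθ1
  set ω₀ := -Real.log p / 2 with hω₀
  have hω₀0 : 0 < ω₀ := by rw [hω₀]; linarith
  -- `L` must not depend on `κ`, so that the errors `600 * L ^ 2 * κ ^ 2` are of second order; the
  -- summand 1 beside `ω₀` leaves room for `η < 1`.
  set L := 32 * (C * (ω₀ + 1) + C ^ 2 + 1) with hL
  have hL1 : 32 ≤ L := by
    rw [hL]
    have : 0 ≤ C * (ω₀ + 1) + C ^ 2 := by positivity
    linarith
  -- This function and the one in `hs` are upper bounds for the two rates divided by `κ`; the choice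
  -- of `θ` makes their limits at 0 negative.
  have hr : Filter.Tendsto (fun κ : ℝ => θ / (2 * p) - q ^ 3 / (6 * (p + θ * κ) ^ 3) +
      600 * L ^ 2 * κ) (nhds 0) (nhds (θ / (2 * p) - q ^ 3 / (6 * (p + θ * 0) ^ 3) +
        600 * L ^ 2 * 0)) := by
    have : ContinuousAt (fun κ : ℝ => θ / (2 * p) - q ^ 3 / (6 * (p + θ * κ) ^ 3) +
        600 * L ^ 2 * κ) 0 := by
      refine ContinuousAt.add (ContinuousAt.sub continuousAt_const
        (ContinuousAt.div continuousAt_const (by fun_prop) ?_)) (by fun_prop)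
      simp; exact hp0.ne'
    exact this
  have hs : Filter.Tendsto (fun κ : ℝ => -(C * θ / (2 * (1 - p))) +
      q ^ 3 * C ^ 2 / (6 * (1 - p - θ * κ) ^ 3) + 600 * L ^ 2 * κ * C) (nhds 0)
      (nhds (-(C * θ / (2 * (1 - p))) +
      q ^ 3 * C ^ 2 / (6 * (1 - p - θ * 0) ^ 3) + 600 * L ^ 2 * 0 * C)) := by
    have : ContinuousAt (fun κ : ℝ => -(C * θ / (2 * (1 - p))) +
      q ^ 3 * C ^ 2 / (6 * (1 - p - θ * κ) ^ 3) + 600 * L ^ 2 * κ * C) 0 := by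
      refine ContinuousAt.add (ContinuousAt.add continuousAt_const
        (ContinuousAt.div continuousAt_const (by fun_prop) ?_)) (by fun_prop)
      simp; exact hq0.ne'
    exact this
  have hr0 : θ / (2 * p) - q ^ 3 / (6 * (p + θ * 0) ^ 3) + 600 * L ^ 2 * 0 < 0 := by
    have : q ^ 3 / (6 * p ^ 3) = q ^ 3 / (3 * p ^ 2) / (2 * p) := by field_simp; ring
    simp only [mul_zero, add_zero]
    rw [this, ← sub_div]
    exact div_neg_of_neg_of_pos (by linarith) (by positivity)
  have hs0 : -(C * θ / (2 * (1 - p))) + q ^ 3 * C ^ 2 / (6 * (1 - p - θ * 0) ^ 3) +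
      600 * L ^ 2 * 0 * C < 0 := by
    have : q ^ 3 * C ^ 2 / (6 * (1 - p) ^ 3) =
        C * (C * q ^ 3 / (3 * (1 - p) ^ 2)) / (2 * (1 - p)) := by field_simp; ring
    simp only [mul_zero, add_zero, sub_zero, zero_mul]
    rw [this, neg_add_eq_sub, ← sub_div]
    exact div_neg_of_neg_of_pos (by nlinarith) (by positivity)
  have hκlim : Filter.Tendsto (fun D : ℕ => 1 / Real.sqrt D) Filter.atTop (nhds 0) := by
    simp only [one_div]
    exact Filter.Tendsto.inv_tendsto_atTop
      (Real.tendsto_sqrt_atTop.comp tendsto_natCast_atTop_atTop)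
  obtain ⟨D, hDr, hDs, hDp, hDL, hD⟩ := ((hκlim.eventually (hr.eventually_lt_const hr0)).and
    ((hκlim.eventually (hs.eventually_lt_const hs0)).and
    ((hκlim.eventually_lt_const (show 0 < (1 / 2 - p) / θ from div_pos (by linarith) hθ0)).and
    ((hκlim.eventually_lt_const (show 0 < 1 / 128 / L by positivity)).and
    (Filter.eventually_gt_atTop 0))))).exists
  set κ := 1 / Real.sqrt D with hκ
  have hκ0 : 0 < κ := by
    have : 0 < Real.sqrt D := Real.sqrt_pos.2 (Nat.cast_pos.2 hD)
    positivity
  have hθκ : θ * κ < 1 / 2 - p := by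
    rw [lt_div_iff₀ hθ0] at hDp; linarith
  have hLκ : L * κ ≤ 1 / 128 := by
    rw [lt_div_iff₀ (by linarith)] at hDL; linarith
  have hθκ0 : 0 < θ * κ := mul_pos hθ0 hκ0
  have hp'0 : 0 < p + θ * κ := by linarith
  have hq'0 : 0 < 1 - (p + θ * κ) := by linarith
  -- Tangent lines lie above the concave logarithm, so linearising at `p` and at `1 - p` errs in the
  -- harmless direction for both colours.
  have hlogp : Real.log (p + θ * κ) ≤ Real.log p + θ * κ / p := by
    have h := Real.log_le_sub_one_of_pos (show 0 < (p + θ * κ) / p by positivity)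
    rw [Real.log_div hp'0.ne' hp0.ne', add_div, div_self hp0.ne'] at h
    linarith
  have hlogq : Real.log (1 - (p + θ * κ)) ≤ Real.log (1 - p) - θ * κ / (1 - p) := by
    have h := Real.log_le_sub_one_of_pos (show 0 < (1 - (p + θ * κ)) / (1 - p) by positivity)
    rw [Real.log_div hq'0.ne' hq0.ne', ← sub_sub, sub_div, div_self hq0.ne'] at h
    rw [← sub_sub]
    linarith
  have hR : ω₀ + Real.log (p + θ * κ) / 2 - (q / (p + θ * κ)) ^ 3 * κ / 6 +
      600 * L ^ 2 * κ ^ 2 < 0 := by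
    have h := mul_neg_of_pos_of_neg hκ0 hDr
    have e : κ * (θ / (2 * p) - q ^ 3 / (6 * (p + θ * κ) ^ 3) + 600 * L ^ 2 * κ) =
        θ * κ / p / 2 - (q / (p + θ * κ)) ^ 3 * κ / 6 + 600 * L ^ 2 * κ ^ 2 := by
      rw [div_pow]; field_simp
    rw [e] at h
    rw [hω₀]
    linarith
  have hB : ω₀ + C / 2 * Real.log (1 - (p + θ * κ)) +
      (q / (1 - (p + θ * κ))) ^ 3 * κ * C ^ 2 / 6 + 600 * L ^ 2 * κ ^ 2 * C < 0 := by
    have h := mul_neg_of_pos_of_neg hκ0 hDs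
    rw [sub_sub] at h
    have e : κ * (-(C * θ / (2 * (1 - p))) + q ^ 3 * C ^ 2 / (6 * (1 - (p + θ * κ)) ^ 3) +
        600 * L ^ 2 * κ * C) = -(C / 2 * (θ * κ / (1 - p))) +
        (q / (1 - (p + θ * κ))) ^ 3 * κ * C ^ 2 / 6 + 600 * L ^ 2 * κ ^ 2 * C := by
      rw [div_pow]; field_simp
    rw [e] at h
    have h2 := mul_le_mul_of_nonneg_left hlogq (show 0 ≤ C / 2 by positivity)
    -- The equation defining `p_C` enters here: `ω₀ + C / 2 * log (1 - p) = 0`, so the constant term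
    -- of the blue rate cancels too.
    rw [hω₀, hlp]
    linarith
  obtain ⟨η, hη0, hη⟩ : ∃ η : ℝ, 0 < η ∧ η < min 1 (min
      (-(ω₀ + Real.log (p + θ * κ) / 2 - (q / (p + θ * κ)) ^ 3 * κ / 6 + 600 * L ^ 2 * κ ^ 2))
      (-(ω₀ + C / 2 * Real.log (1 - (p + θ * κ)) +
      (q / (1 - (p + θ * κ))) ^ 3 * κ * C ^ 2 / 6 + 600 * L ^ 2 * κ ^ 2 * C))) :=
    exists_between (lt_min one_pos (lt_min (by linarith) (by linarith)))
  obtain ⟨hη1, hη'⟩ := lt_min_iff.1 hη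
  obtain ⟨hη2, hη3⟩ := lt_min_iff.1 hη'
  have hLL : C * (ω₀ + η) + C ^ 2 + 1 ≤ L ^ 2 / 32 := by
    have h1 : C * (ω₀ + η) + C ^ 2 + 1 ≤ L / 32 := by rw [hL]; nlinarith only [hC, hη1]
    nlinarith only [h1, hL1]
  have hLC : C ≤ L := by rw [hL]; nlinarith only [hC, hω₀0]
  have hbp : b ≤ (p + θ * κ) / 2 := by linarith only [hb, hθκ0]
  obtain ⟨ℓ₀, hℓ₀, hmain⟩ := exp_le_ramseyNumber_of_rates hC hD (p := p + θ * κ) (b := b) (κ := κ)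
    (L := L) (ω := ω₀ + η) hp'0 (by linarith only [hθκ]) (by positivity) hbp hκ
    (by positivity) hLL hLC hLκ (by rw [← hq]; linarith only [hη2]) (by rw [← hq]; linarith only [hη3])
  have hrpow : p ^ (-(1 / 2) : ℝ) = Real.exp ω₀ := by
    rw [Real.rpow_def_of_pos hp0, hω₀]; congr 1; ring
  refine ⟨Real.exp (ω₀ + η) - Real.exp ω₀, sub_pos.2 (Real.exp_lt_exp.2 (by linarith)), ℓ₀, hℓ₀,
    fun ℓ hℓ => ?_⟩
  rw [hrpow, add_sub_cancel, ← Real.exp_nat_mul, mul_comm]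
  exact hmain ℓ hℓ
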